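/- Let $\mathbb N=\{1,2,\dots\}$, $\mathbb N_0=\mathbb N\cup\{0\}$, $\Omega=\{-1,1\}^{\mathbb N}$, and $(T_i\sigma)_j=\sigma_{ij}$, $T_if=f\circ T_i$ for $i,j\in\mathbb N$. **Potential.** Let $\mathcal A$ be a collection of nonempty finite subsets of $\mathbb N$ and $(J_A)_{A\in\mathcal A}$ real numbers that are consistent: $iA=i'A'$ with $A,A'\in\mathcal A$, $i,i'\in\mathbb N$ implies $J_A=J_{A'}$. Let $U$ be the potential on $\Omega$ given by $$U(iA,\sigma)=J_A\prod_{j\in A}(T_i\sigma)_j\quad(A\in\mathcal A,\ i\in\mathbb N),\qquad U(B,\sigma)=0\ \text{ for all other finite } B\subset\mathbb N,$$ and assume $\sum_{B\ni i}\max_\sigma|U(B,\sigma)|<\infty$ for all $i\in\mathbb N$. Assume that the set of primes dividing some element of $\bigcup_{A\in\mathcal A}A$ is finite and nonempty, say $\{p_1<\dots<p_d\}$ with $d\ge1$. For $x\in\mathbb N_0^d$ write $p^x=\prod_ip_i^{x_i}$. Let $V$ be the corresponding potential on $\{-1,1\}^{\mathbb N_0^d}$: identifying each $A\in\mathcal A$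 with its set $\hat A\subset\mathbb N_0^d$ of exponent vectors, $V(x+\hat A,\tau)=J_A\prod_{y\in\hat A}\tau_{x+y}$ for $x\in\mathbb N_0^d$, and $V=0$ on all other finite sets. Gibbs measures for a potential $\Phi$ are the probability measures satisfying the Dobrushin–Lanford–Ruelle equations for the finite-volume weights $e^{-H_\Lambda}$, $H_\Lambda=\sum_{A\cap\Lambda\ne\emptyset}\Phi(A,\cdot)$. Assume that $U$ is layer unique, i.e. $V$ has exactly one Gibbs measure $\mu^V_\infty$. **Counting.** Let $\mathcal K$ be the set of $r\in\mathbb N$ divisible by none of the $p_i$, and $\Lambda^r_N=\{x\in\mathbb N_0^d: r\,p^x\le N\}$. Let $D(\rho)=\{x\in\mathbb N_0^d:\sum_ix_i\log p_i\le\rho\}$ and, for $\ell\ge1$, $\rho^-(\ell)=\inf\{\rho\ge0:|D(\rho)|=\ell\}$, $\rho^+(\ell)=\sup\{\rho\ge0:|D(\rho)|=\ell\}$. Let $\kappa=1-\sum_i\frac1{p_i}+\sum_{i<j}\frac1{p_ip_j}-\dots+\frac{(-1)^d}{p_1\cdots p_d}$. **First-layer functions.** Let $f:\Omega\to\mathbb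 R$ be a first-layer function: $f(\sigma)=f^*(\tau^1)$ with $\tau^1_x=\sigma_{p^x}$ and $f^*:\{-1,1\}^{\mathbb N_0^d}\to\mathbb R$ continuous. With $(\theta_x\tau)_y=\tau_{x+y}$ and $\theta_xf^*=f^*\circ\theta_x$, put $$\Psi_\ell(f^*|V)=\log\mathbb E_{\mu^V_\infty}\Bigl(e^{\sum_{x\in\Lambda^r_N}\theta_xf^*}\Bigr)\quad\text{whenever } r\in\mathcal K,\ |\Lambda^r_N|=\ell$$ (the set $\Lambda^r_N$ depends only on its cardinality). **Theorem.** Under these assumptions $U$ has exactly one Gibbs measure $\mu^U_\infty$, and for every first-layer function $f$ the limit $$\mathcal P^M(f|\mu^U_\infty)=\lim_{N\to\infty}\frac1N\log\mathbb E_{\mu^U_\infty}\Bigl(e^{\sum_{i=1}^NT_if}\Bigr)$$ exists and is given by the absolutely convergent series $$\mathcal P^M(f|\mu^U_\infty)=\kappa\sum_{j=1}^\infty\bigl(e^{-\rho^-(j)}-e^{-\rho^+(j)}\bigr)\Psi_j(f^*|V).$$ As a consequence, under $\mu^U_\infty$ the random variables $X_N(f)=\frac1N\sum_{i=1}^NT_if$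 satisfy the large deviation principle with speed $N$ and rate function $I_f(x)=\sup_{t\in\mathbb R}\bigl(tx-\mathcal P^M(tf|\mu^U_\infty)\bigr)$: $I_f$ is $[0,\infty]$-valued and lower semicontinuous, $\limsup_N\frac1N\log\mu^U_\infty(X_N(f)\in F)\le-\inf_FI_f$ for closed $F\subset\mathbb R$, and $\liminf_N\frac1N\log\mu^U_\infty(X_N(f)\in G)\ge-\inf_GI_f$ for open $G\subset\mathbb R$. -/

import Mathlib

open MeasureTheory Filter Topology

noncomputable section

namespace MultGibbs

/-! ### Spin systems, potentials and Gibbs measures -/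

/-- The single-spin space `{-1, 1}`. -/
abbrev Spin : Type := ℤˣ

instance : DiscreteMeasurableSpace Spin where
  forall_measurableSet s := ⟨Units.val '' s, MeasurableSet.of_discrete,
    Set.preimage_image_eq s Units.val_injective⟩

instance : BorelSpace Spin where
  measurable_eq := by
    rw [borel_eq_top_of_discrete]
    exact eq_top_iff.2 fun s _ => MeasurableSet.of_discrete

/-- The real number `1` or `-1` given by a spin. -/
def Spin.val (s : Spin) : ℝ := ((s : ℤ) : ℝ)

/-- Spin configurations on a set of sites `S`, with product topology and product `σ`-algebra. -/
abbrev Config (S : Type) : Type := S → Spin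

/-- An interaction assigns an energy to each finite set of sites and each configuration. -/
abbrev Interaction (S : Type) : Type := Finset S → Config S → ℝ

/-- `∑_{A ∋ i} max_σ |Φ(A, σ)| < ∞` for every site `i`. -/
def AbsolutelySummable {S : Type} (Φ : Interaction S) : Prop :=
  ∀ i : S, Summable fun A : {A : Finset S // i ∈ A} => ⨆ σ : Config S, |Φ A.1 σ|

/-- `H_Λ(σ) = ∑_{A ∩ Λ ≠ ∅} Φ(A, σ)`. -/
def hamiltonian {S : Type} (Φ : Interaction S) (Λ : Finset S) (σ : Config S) : ℝ :=
  ∑' A : {A : Finset S // ¬ Disjoint A Λ}, Φ A.1 σ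

/-- The configuration equal to `ζ` on `Λ` and to `η` off `Λ`. -/
def glue {S : Type} [DecidableEq S] (Λ : Finset S) (ζ : Λ → Spin) (η : Config S) : Config S :=
  fun i => if h : i ∈ Λ then ζ ⟨i, h⟩ else η i

/-- The partition function in `Λ` with boundary condition `η`. -/
def partitionFunction {S : Type} [DecidableEq S] (Φ : Interaction S) (Λ : Finset S) (η : Config S) : ℝ :=
  ∑ ζ : Λ → Spin, Real.exp (-hamiltonian Φ Λ (glue Λ ζ η))

/-- The Gibbs distribution in `Λ` with boundary condition `η`, a measure on all configurations. -/
def specification {S : Type} [DecidableEq S] (Φ : Interaction S) (Λ : Finset S) (η : Config S) :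
    Measure (Config S) :=
  ∑ ζ : Λ → Spin,
    ENNReal.ofReal (Real.exp (-hamiltonian Φ Λ (glue Λ ζ η)) / partitionFunction Φ Λ η) •
      Measure.dirac (glue Λ ζ η)

/-- Infinite-volume Gibbs measures, through the Dobrushin–Lanford–Ruelle equations. -/
structure IsGibbs {S : Type} [DecidableEq S] (Φ : Interaction S) (μ : Measure (Config S)) : Prop where
  isProbabilityMeasure : IsProbabilityMeasure μ
  dlr : ∀ (Λ : Finset S) (E : Set (Config S)), MeasurableSet E →
    ∫⁻ η, specification Φ Λ η E ∂μ = μ E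

/-- `μ` is the one and only Gibbs measure for `Φ`. -/
def IsUniqueGibbs {S : Type} [DecidableEq S] (Φ : Interaction S) (μ : Measure (Config S)) : Prop :=
  IsGibbs Φ μ ∧ ∀ ν : Measure (Config S), IsGibbs Φ ν → ν = μ

/-! ### The multiplicative potential and its primes -/

/-- The multiplicative shift `(T_i σ)_j = σ_{ij}`. -/
def multShift (i : ℕ+) (σ : Config ℕ+) : Config ℕ+ := fun j => σ (i * j)

/-- The dilate `iA = {ij : j ∈ A}`. -/
def dilate (i : ℕ+) (A : Finset ℕ+) : Finset ℕ+ := A.image fun j => i * j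

/-- The base couplings assign a single value to each dilate: `iA = i'A'` forces `J_A = J_{A'}`. -/
def Consistent (𝒜 : Set (Finset ℕ+)) (J : Finset ℕ+ → ℝ) : Prop :=
  ∀ A ∈ 𝒜, ∀ A' ∈ 𝒜, ∀ i i' : ℕ+, dilate i A = dilate i' A' → J A = J A'

open Classical in
/-- The potential generated by the couplings `J_A`, `A ∈ 𝒜`:
`U(iA, σ) = J_A ∏_{j ∈ A} (T_i σ)_j`, and `U(B, σ) = 0` if `B` is not such a dilate
(see `multPotential_dilate` and `multPotential_eq_zero`). -/
def multPotential (𝒜 : Set (Finset ℕ+)) (J : Finset ℕ+ → ℝ) : Interaction ℕ+ := fun B σ =>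
  if h : ∃ A ∈ 𝒜, ∃ i : ℕ+, B = dilate i A then J h.choose * ∏ j ∈ B, (σ j).val else 0

theorem multPotential_dilate {𝒜 : Set (Finset ℕ+)} {J : Finset ℕ+ → ℝ} (hJ : Consistent 𝒜 J)
    {A : Finset ℕ+} (hA : A ∈ 𝒜) (i : ℕ+) (σ : Config ℕ+) :
    multPotential 𝒜 J (dilate i A) σ = J A * ∏ j ∈ A, (multShift i σ j).val := by
  have h : ∃ A' ∈ 𝒜, ∃ i' : ℕ+, dilate i A = dilate i' A' := ⟨A, hA, i, rfl⟩
  obtain ⟨hm, i', hi'⟩ := h.choose_spec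
  rw [multPotential, dif_pos h, hJ _ hm A hA i' i hi'.symm]
  congr 1
  rw [dilate, Finset.prod_image (fun a _ b _ hab => mul_left_cancel hab)]
  rfl

theorem multPotential_eq_zero {𝒜 : Set (Finset ℕ+)} {J : Finset ℕ+ → ℝ} {B : Finset ℕ+}
    (hB : ¬ ∃ A ∈ 𝒜, ∃ i : ℕ+, B = dilate i A) (σ : Config ℕ+) :
    multPotential 𝒜 J B σ = 0 := by
  rw [multPotential, dif_neg hB]

/-- The primes occurring in the factorization of the elements of `⋃ 𝒜`. -/
def basePrimes (𝒜 : Set (Finset ℕ+)) : Set ℕ :=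
  {q | q.Prime ∧ ∃ A ∈ 𝒜, ∃ n ∈ A, q ∣ (n : ℕ)}

/-! ### Layers -/

/-- The sites `ℕ₀^d` of a layer. -/
abbrev LayerSite (d : ℕ) : Type := Fin d → ℕ

/-- The vector of exponents of `p_1, …, p_d` in `n`. -/
def exponents {d : ℕ} (p : Fin d → ℕ) (n : ℕ+) : LayerSite d :=
  fun i => (n : ℕ).factorization (p i)

/-- `(x + C)` for `C ⊆ ℕ₀^d`. -/
def translate {d : ℕ} (x : LayerSite d) (C : Finset (LayerSite d)) : Finset (LayerSite d) :=
  C.image fun y => x + y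

/-- The shift `(θ_x τ)_y = τ_{x+y}`. -/
def layerShift {d : ℕ} (x : LayerSite d) (τ : Config (LayerSite d)) : Config (LayerSite d) :=
  fun y => τ (x + y)

open Classical in
/-- The layer potential on `ℕ₀^d`, with `A ∈ 𝒜` identified with its set of exponent vectors:
`V(x + A, τ) = J_A ∏_{y ∈ A} (θ_x τ)_y`, and `V(B, τ) = 0` if `B` is not such a translate
(see `layerPotential_translate` and `layerPotential_eq_zero`). -/
def layerPotential {d : ℕ} (p : Fin d → ℕ) (𝒜 : Set (Finset ℕ+)) (J : Finset ℕ+ → ℝ) :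
    Interaction (LayerSite d) := fun B τ =>
  if h : ∃ A ∈ 𝒜, ∃ x : LayerSite d, B = translate x (A.image (exponents p)) then
    J h.choose * ∏ y ∈ B, (τ y).val
  else 0

/-- The number `∏ p_i ^ x_i`. -/
def primePower {d : ℕ} (p : Fin d → ℕ) (x : LayerSite d) : ℕ := ∏ i, p i ^ x i

theorem primePower_exponents {d : ℕ} {p : Fin d → ℕ} (hp : Function.Injective p) {n : ℕ+}
    (hn : ∀ q : ℕ, q.Prime → q ∣ (n : ℕ) → q ∈ Set.range p) :
    primePower p (exponents p n) = n := by
  conv_rhs => rw [← Nat.prod_factorization_pow_eq_self n.ne_zero]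
  have h0 : primePower p (exponents p n) =
      ∏ q ∈ Finset.univ.image p, q ^ (n : ℕ).factorization q := by
    rw [Finset.prod_image (fun a _ b _ h => hp h)]
    rfl
  rw [h0, Finsupp.prod]
  symm
  apply Finset.prod_subset
  · intro q hq
    rw [Nat.support_factorization, Nat.mem_primeFactors] at hq
    obtain ⟨i, rfl⟩ := hn q hq.1 hq.2.1
    exact Finset.mem_image_of_mem _ (Finset.mem_univ i)
  · intro q _ hq
    rw [Finsupp.notMem_support_iff.1 hq, pow_zero]

theorem layerPotential_translate {d : ℕ} {p : Fin d → ℕ} {𝒜 : Set (Finset ℕ+)}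
    {J : Finset ℕ+ → ℝ} (hJ : Consistent 𝒜 J) (hp : Function.Injective p)
    (hprimes : Set.range p = basePrimes 𝒜) {A : Finset ℕ+} (hA : A ∈ 𝒜) (x : LayerSite d)
    (τ : Config (LayerSite d)) :
    layerPotential p 𝒜 J (translate x (A.image (exponents p))) τ =
      J A * ∏ n ∈ A, (layerShift x τ (exponents p n)).val := by
  have hsm : ∀ A ∈ 𝒜, ∀ n ∈ A, primePower p (exponents p n) = (n : ℕ) := by
    intro A hA n hn
    refine primePower_exponents hp fun q hq hqn => ?_
    rw [hprimes]
    exact ⟨hq, A, hA, n, hn, hqn⟩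
  have hpos : ∀ x : LayerSite d, 0 < primePower p x := fun x =>
    Finset.prod_pos fun i _ => pow_pos (by
      have : p i ∈ basePrimes 𝒜 := hprimes ▸ Set.mem_range_self i
      exact this.1.pos) _
  have himg : ∀ A ∈ 𝒜, ∀ x : LayerSite d,
      (translate x (A.image (exponents p))).image (fun y => (⟨primePower p y, hpos y⟩ : ℕ+)) =
        dilate ⟨primePower p x, hpos x⟩ A := by
    intro A hA x
    unfold translate dilate
    rw [Finset.image_image, Finset.image_image]
    refine Finset.image_congr fun n hn => PNat.eq ?_
    have h1 : primePower p (x + exponents p n) = primePower p x * primePower p (exponents p n) := by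
      simp only [primePower, Pi.add_apply, pow_add, Finset.prod_mul_distrib]
    rw [hsm A hA n hn] at h1
    exact h1
  have h : ∃ A' ∈ 𝒜, ∃ x' : LayerSite d,
      translate x (A.image (exponents p)) = translate x' (A'.image (exponents p)) :=
    ⟨A, hA, x, rfl⟩
  obtain ⟨hm, x', hx'⟩ := h.choose_spec
  have hd := congrArg (Finset.image fun y => (⟨primePower p y, hpos y⟩ : ℕ+)) hx'
  rw [himg A hA, himg _ hm] at hd
  rw [layerPotential, dif_pos h, hJ _ hm A hA _ _ hd.symm]
  congr 1
  rw [translate, Finset.prod_image (fun a _ b _ hab => add_left_cancel hab), Finset.prod_image]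
  · rfl
  · intro a ha b hb hab
    apply PNat.eq
    rw [← hsm A hA a ha, ← hsm A hA b hb, hab]

theorem layerPotential_eq_zero {d : ℕ} {p : Fin d → ℕ} {𝒜 : Set (Finset ℕ+)}
    {J : Finset ℕ+ → ℝ} {B : Finset (LayerSite d)}
    (hB : ¬ ∃ A ∈ 𝒜, ∃ x : LayerSite d, B = translate x (A.image (exponents p)))
    (τ : Config (LayerSite d)) : layerPotential p 𝒜 J B τ = 0 := by
  rw [layerPotential, dif_neg hB]

/-- The first layer `τ^1_x = σ_{∏ p_i ^ x_i}` of `σ`. (The number is positive when the `p_i` are.) -/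
def firstLayer {d : ℕ} (p : Fin d → ℕ) (σ : Config ℕ+) : Config (LayerSite d) :=
  fun x => σ (primePower p x).toPNat'

/-- `f` is a first-layer function, `f(σ) = f^*(τ^1)` with `f^*` continuous. -/
def IsFirstLayer {d : ℕ} (p : Fin d → ℕ) (f : Config ℕ+ → ℝ)
    (fstar : Config (LayerSite d) → ℝ) : Prop :=
  Continuous fstar ∧ ∀ σ, f σ = fstar (firstLayer p σ)

/-- `Λ^r_N = {x ∈ ℕ₀^d : r ∏ p_i ^ x_i ≤ N}` (see `mem_layerBox`). -/
def layerBox {d : ℕ} (p : Fin d → ℕ) (r N : ℕ) : Finset (LayerSite d) :=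
  (Fintype.piFinset fun _ : Fin d => Finset.range (N + 1)).filter
    fun x => r * primePower p x ≤ N

theorem mem_layerBox {d : ℕ} {p : Fin d → ℕ} (hp : ∀ i, 2 ≤ p i) {r : ℕ} (hr : 1 ≤ r) (N : ℕ)
    (x : LayerSite d) : x ∈ layerBox p r N ↔ r * primePower p x ≤ N := by
  simp only [layerBox, Finset.mem_filter, Fintype.mem_piFinset, Finset.mem_range,
    and_iff_right_iff_imp]
  intro h i
  have h1 : x i < p i ^ x i := Nat.lt_pow_self (hp i)
  have h2 : p i ^ x i ≤ primePower p x :=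
    Finset.single_le_prod' (f := fun j => p j ^ x j)
      (fun j _ => Nat.one_le_pow _ _ (by have := hp j; omega)) (Finset.mem_univ i)
  have h3 : primePower p x ≤ r * primePower p x := Nat.le_mul_of_pos_left _ hr
  omega

/-- The positive integers divisible by none of `p_1, …, p_d`. -/
def layerIndices {d : ℕ} (p : Fin d → ℕ) : Set ℕ := {r | 1 ≤ r ∧ ∀ i, ¬ p i ∣ r}

/-- `log E_ν exp (∑_{x ∈ Λ} θ_x f^*)`. -/
def layerPressure {d : ℕ} (ν : Measure (Config (LayerSite d)))
    (fstar : Config (LayerSite d) → ℝ) (Λ : Finset (LayerSite d)) : ℝ :=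
  Real.log (∫ τ, Real.exp (∑ x ∈ Λ, fstar (layerShift x τ)) ∂ν)

open Classical in
/-- `Ψ_ℓ`: the layer pressure of any `Λ^r_N` with `|Λ^r_N| = ℓ` (see `Psi_card_layerBox`). -/
def Psi {d : ℕ} (p : Fin d → ℕ) (ν : Measure (Config (LayerSite d)))
    (fstar : Config (LayerSite d) → ℝ) (l : ℕ) : ℝ :=
  if h : ∃ a : ℕ × ℕ, a.1 ∈ layerIndices p ∧ (layerBox p a.1 a.2).card = l then
    layerPressure ν fstar (layerBox p h.choose.1 h.choose.2)
  else 0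

theorem layerBox_eq_of_card_eq {d : ℕ} {p : Fin d → ℕ} (hp : ∀ i, 2 ≤ p i) {r s N M : ℕ}
    (hr : 1 ≤ r) (hs : 1 ≤ s) (h : (layerBox p r N).card = (layerBox p s M).card) :
    layerBox p r N = layerBox p s M := by
  have key : ∀ {r N}, 1 ≤ r → ∀ x, x ∈ layerBox p r N ↔ primePower p x ≤ N / r := by
    intro r N hr x
    rw [mem_layerBox hp hr, Nat.le_div_iff_mul_le hr, mul_comm]
  rcases le_total (N / r) (M / s) with hle | hle
  · exact Finset.eq_of_subset_of_card_le
      (fun x hx => (key hs x).2 (((key hr x).1 hx).trans hle)) h.ge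
  · exact (Finset.eq_of_subset_of_card_le
      (fun x hx => (key hr x).2 (((key hs x).1 hx).trans hle)) h.le).symm

theorem Psi_card_layerBox {d : ℕ} {p : Fin d → ℕ} (hp : ∀ i, 2 ≤ p i)
    (ν : Measure (Config (LayerSite d))) (fstar : Config (LayerSite d) → ℝ) {r : ℕ}
    (hr : r ∈ layerIndices p) (N : ℕ) :
    Psi p ν fstar (layerBox p r N).card = layerPressure ν fstar (layerBox p r N) := by
  have h : ∃ a : ℕ × ℕ, a.1 ∈ layerIndices p ∧
      (layerBox p a.1 a.2).card = (layerBox p r N).card := ⟨(r, N), hr, rfl⟩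
  rw [Psi, dif_pos h, layerBox_eq_of_card_eq hp h.choose_spec.1.1 hr.1 h.choose_spec.2]

/-! ### The constants from lattice-point counting -/

/-- `D(ρ) = {x ∈ ℕ₀^d : ∑ x_i log p_i ≤ ρ}`. -/
def latticeSimplex {d : ℕ} (p : Fin d → ℕ) (ρ : ℝ) : Set (LayerSite d) :=
  {x | ∑ i, (x i : ℝ) * Real.log (p i) ≤ ρ}

/-- `ρ^-(ℓ) = inf {ρ ≥ 0 : |D(ρ)| = ℓ}`. -/
def rhoMinus {d : ℕ} (p : Fin d → ℕ) (l : ℕ) : ℝ :=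
  sInf {ρ : ℝ | 0 ≤ ρ ∧ (latticeSimplex p ρ).ncard = l}

/-- `ρ^+(ℓ) = sup {ρ ≥ 0 : |D(ρ)| = ℓ}`. -/
def rhoPlus {d : ℕ} (p : Fin d → ℕ) (l : ℕ) : ℝ :=
  sSup {ρ : ℝ | 0 ≤ ρ ∧ (latticeSimplex p ρ).ncard = l}

/-- `κ = 1 - ∑_i 1/p_i + ∑_{i<j} 1/(p_i p_j) - ⋯ + (-1)^d / (p_1 ⋯ p_d)`. -/
def kappa {d : ℕ} (p : Fin d → ℕ) : ℝ :=
  ∑ T : Finset (Fin d), (-1) ^ T.card / ∏ i ∈ T, (p i : ℝ)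

/-! ### Pressure and large deviations -/

/-- `∑_{i=1}^N T_i f`. -/
def multSum (f : Config ℕ+ → ℝ) (N : ℕ) (σ : Config ℕ+) : ℝ :=
  ∑ i ∈ Finset.range N, f (multShift i.succPNat σ)

/-- `(1/N) log E_μ exp (∑_{i=1}^N T_i f)`. -/
def finitePressure (μ : Measure (Config ℕ+)) (f : Config ℕ+ → ℝ) (N : ℕ) : ℝ :=
  1 / (N : ℝ) * Real.log (∫ σ, Real.exp (multSum f N σ) ∂μ)

/-- The multiplicative pressure: the limit of the `finitePressure`s, meaningful when it exists. -/
def multPressure (μ : Measure (Config ℕ+)) (f : Config ℕ+ → ℝ) : ℝ :=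
  limUnder atTop (finitePressure μ f)

/-- The averages `X_N(f) = (1/N) ∑_{i=1}^N T_i f`. -/
def multAverage (f : Config ℕ+ → ℝ) (N : ℕ) (σ : Config ℕ+) : ℝ :=
  1 / (N : ℝ) * multSum f N σ

/-- The Legendre transform `I(x) = sup_t (t x - P(t))`, with values in `[-∞, ∞]`. -/
def legendre (P : ℝ → ℝ) (x : ℝ) : EReal := ⨆ t : ℝ, ((t * x - P t : ℝ) : EReal)

/-- The real random variables `X_N` satisfy the large deviation principle under `μ`, with speed
`N` and rate function `I`. -/
structure SatisfiesLDP {Ω : Type} [MeasurableSpace Ω] (μ : Measure Ω) (X : ℕ → Ω → ℝ)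
    (I : ℝ → EReal) : Prop where
  nonneg : ∀ x, 0 ≤ I x
  lowerSemicontinuous : LowerSemicontinuous I
  upper : ∀ F : Set ℝ, IsClosed F →
    limsup (fun N : ℕ => ((1 / (N : ℝ) : ℝ) : EReal) * ENNReal.log (μ {ω | X N ω ∈ F})) atTop
      ≤ -(⨅ x ∈ F, I x)
  lower : ∀ G : Set ℝ, IsOpen G →
    -(⨅ x ∈ G, I x) ≤
      liminf (fun N : ℕ => ((1 / (N : ℝ) : ℝ) : EReal) * ENNReal.log (μ {ω | X N ω ∈ G})) atTop

end MultGibbs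

end

/-!
Every positive integer is uniquely `r ∏ p_i ^ x_i` with `r` divisible by none of the `p_i`. This
splits `ℕ` into layers, one copy of `ℕ₀^d` for each `r`, and a set which interacts lies inside a
single layer, where the potential `U` is the layer potential `V` (`multPotential_image_site`).
Resampling the spins of a finite set in one layer therefore leaves the other layers alone and
follows the specification of `V` (`specification_image_site`). Two facts follow.

* The law `layerProduct` making the layers independent with common law `μV` is a Gibbs measure: it
  is preserved by resampling in one layer, and resampling a general finite set is a succession of
  such steps, because different layers do not see each other (`specification_union`).
* If `ν` is any Gibbs measure for `U` and `B` is an event off the layer `r`, the law of the layer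
  `r` under `ν` conditioned on `B` is Gibbs for `V`, hence equal to `μV`. Thus the layers are
  independent with law `μV` under `ν` (`IsGibbs.measure_inter_layer`).

For a first-layer function the sum `∑_{i ≤ N} T_i f` is a sum over the layers `r ≤ N` of functions
of one layer each, so independence gives `(1/N) log E exp (∑_{i ≤ N} T_i f) = (1/N) ∑_r Ψ_{|Λ^r_N|}`
(`finitePressure_layerProduct`). The layers with `|Λ^r_N| = ℓ` are those with
`log (N / r)` between `ρ^-(ℓ)` and `ρ^+(ℓ)`; since the layer indices form a periodic set of density
`κ`, there are `κ (e^{-ρ^-(ℓ)} - e^{-ρ^+(ℓ)}) N + O(1)` of them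
(`exists_abs_card_layersOfCard_sub_le`). Moreover `|D(ρ)| ^ 3 = O(e^ρ)`, so that there are at most
`O(N / ℓ ^ 3)` layers of size `ℓ`, while `|Ψ_ℓ| ≤ ℓ max |f^*|`; dominated convergence yields the
series (`tendsto_finitePressure`).

The derivative of `t ↦ Ψ_ℓ(t f^*)` is bounded by `ℓ max |f^*|` as well, so the series can be
differentiated termwise and the pressure is differentiable in `t`. The large deviation principle is
then the Gärtner–Ellis theorem for bounded real random variables
(`satisfiesLDP_of_tendsto_scaledCgf`): the upper bound is Chernoff's inequality and compactness. For
the lower bound, exponential tilting treats the points `P'(t)` (`le_liminf_of_hasDerivAt`), and by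
Darboux's theorem every point of finite rate is a limit of such points at no greater cost
(`exists_deriv_near`).
-/

noncomputable section

namespace MultGibbs

/-! ### The arithmetic of layers -/

section Sites

variable {d : ℕ} {p : Fin d → ℕ}

theorem primePower_pos (hp : ∀ i, (p i).Prime) (x : LayerSite d) : 0 < primePower p x :=
  Finset.prod_pos fun i _ => pow_pos (hp i).pos _

theorem primePower_add (x y : LayerSite d) :
    primePower p (x + y) = primePower p x * primePower p y := by
  simp only [primePower, Pi.add_apply, pow_add, Finset.prod_mul_distrib]

theorem factorization_primePower (hp : ∀ i, (p i).Prime) (hinj : Function.Injective p)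
    (x : LayerSite d) (i : Fin d) : (primePower p x).factorization (p i) = x i := by
  unfold primePower
  rw [Nat.factorization_prod fun j _ => pow_ne_zero _ (hp j).ne_zero, Finsupp.finsetSum_apply,
    Finset.sum_eq_single i]
  · simp [Nat.factorization_pow, (hp i).factorization_self]
  · intro j _ hji
    rw [Nat.factorization_pow, Finsupp.smul_apply, (hp j).factorization, Finsupp.single_eq_of_ne,
      smul_zero]
    exact fun h => hji (hinj h.symm)
  · simp

theorem two_le_of_prime (hp : ∀ i, (p i).Prime) (i : Fin d) : 2 ≤ p i := (hp i).two_le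

/-- The site `r ∏ p_i ^ x_i` of `ℕ`, with coordinate `x` in the layer with index `r`. -/
def site (p : Fin d → ℕ) (r : layerIndices p) (x : LayerSite d) : ℕ+ :=
  ((r : ℕ) * primePower p x).toPNat'

theorem coe_site (hp : ∀ i, (p i).Prime) (r : layerIndices p) (x : LayerSite d) :
    (site p r x : ℕ) = r * primePower p x :=
  PNat.toPNat'_coe (Nat.mul_pos r.2.1 (primePower_pos hp x))

theorem exponents_site (hp : ∀ i, (p i).Prime) (hinj : Function.Injective p)
    (r : layerIndices p) (x : LayerSite d) : exponents p (site p r x) = x := by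
  ext i
  have hr : (r : ℕ) ≠ 0 := (Nat.pos_of_ne_zero (by have := r.2.1; omega)).ne'
  rw [exponents, coe_site hp, Nat.factorization_mul hr (primePower_pos hp x).ne',
    Finsupp.add_apply, factorization_primePower hp hinj,
    Nat.factorization_eq_zero_of_not_dvd (r.2.2 i), zero_add]

theorem site_injective (hp : ∀ i, (p i).Prime) (hinj : Function.Injective p) :
    Function.Injective fun a : layerIndices p × LayerSite d => site p a.1 a.2 := by
  rintro ⟨r, x⟩ ⟨s, y⟩ h
  have hxy : x = y := by
    rw [← exponents_site hp hinj r x, ← exponents_site hp hinj s y]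
    exact congrArg _ h
  subst hxy
  have h' : (site p r x : ℕ) = site p s x := congrArg _ h
  rw [coe_site hp, coe_site hp] at h'
  exact Prod.ext (Subtype.ext (Nat.eq_of_mul_eq_mul_right (primePower_pos hp x) h')) rfl

theorem primePower_exponents_dvd (hp : ∀ i, (p i).Prime) (hinj : Function.Injective p) (n : ℕ+) :
    primePower p (exponents p n) ∣ n := by
  refine Finset.prod_dvd_of_isRelPrime (fun i _ j _ hij => ?_) fun i _ => Nat.ordProj_dvd _ _
  exact Nat.coprime_iff_isRelPrime.1
    (Nat.Coprime.pow _ _ ((Nat.coprime_primes (hp i) (hp j)).2 (hinj.ne hij)))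

theorem site_surjective (hp : ∀ i, (p i).Prime) (hinj : Function.Injective p) :
    Function.Surjective fun a : layerIndices p × LayerSite d => site p a.1 a.2 := by
  intro n
  obtain ⟨r, hr⟩ := primePower_exponents_dvd hp hinj n
  have hr0 : r ≠ 0 := by
    rintro rfl
    simp at hr
  have hrK : r ∈ layerIndices p := by
    refine ⟨Nat.pos_of_ne_zero hr0, fun i hi => ?_⟩
    have h1 := congrArg (fun m : ℕ => m.factorization (p i)) hr
    simp only [Nat.factorization_mul (primePower_pos hp _).ne' hr0, Finsupp.add_apply,
      factorization_primePower hp hinj] at h1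
    have h2 := (hp i).factorization_pos_of_dvd hr0 hi
    simp only [exponents] at h1
    omega
  refine ⟨(⟨r, hrK⟩, exponents p n), PNat.eq ?_⟩
  rw [coe_site hp, mul_comm, ← hr]

/-- Every positive integer has a unique layer index and a unique coordinate within its layer. -/
def siteEquiv (hp : ∀ i, (p i).Prime) (hinj : Function.Injective p) :
    layerIndices p × LayerSite d ≃ ℕ+ :=
  Equiv.ofBijective _ ⟨site_injective hp hinj, site_surjective hp hinj⟩

theorem site_add (hp : ∀ i, (p i).Prime) (r : layerIndices p) (x y : LayerSite d) :
    (site p r (x + y) : ℕ) = site p r x * primePower p y := by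
  rw [coe_site hp, coe_site hp, primePower_add, mul_assoc]

theorem site_right_injective (hp : ∀ i, (p i).Prime) (hinj : Function.Injective p)
    (r : layerIndices p) : Function.Injective (site p r) := fun x y h => by
  rw [← exponents_site hp hinj r x, h, exponents_site hp hinj]

/-- The restriction `τ^r_x = σ_{r ∏ p_i ^ x_i}` of `σ` to the layer `r`. -/
def layer (p : Fin d → ℕ) (r : layerIndices p) (σ : Config ℕ+) : Config (LayerSite d) :=
  fun x => σ (site p r x)

theorem measurable_layer (r : layerIndices p) : Measurable (layer p r) :=
  measurable_pi_lambda _ fun _ => measurable_pi_apply _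

/-- A configuration on `ℕ` is the same thing as a family of configurations of the layers. -/
def layersEquiv (hp : ∀ i, (p i).Prime) (hinj : Function.Injective p) :
    Config ℕ+ ≃ᵐ (layerIndices p → Config (LayerSite d)) where
  toFun σ r := layer p r σ
  invFun τ n := τ ((siteEquiv hp hinj).symm n).1 ((siteEquiv hp hinj).symm n).2
  left_inv σ := by
    funext n
    exact congrArg σ ((siteEquiv hp hinj).apply_symm_apply n)
  right_inv τ := by
    funext r x
    have h : (siteEquiv hp hinj).symm (site p r x) = (r, x) :=
      (siteEquiv hp hinj).symm_apply_apply (r, x)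
    simp only [layer, h]
  measurable_toFun := measurable_pi_lambda _ fun r => measurable_layer r
  measurable_invFun := measurable_pi_lambda _ fun n => by
    change Measurable fun τ : layerIndices p → Config (LayerSite d) =>
      τ ((siteEquiv hp hinj).symm n).1 ((siteEquiv hp hinj).symm n).2
    fun_prop

end Sites

/-! ### Specifications of summable interactions -/

section Specification

variable {S : Type}

theorem hamiltonian_eq_tsum_indicator (Φ : Interaction S) (Λ : Finset S) (σ : Config S) :
    hamiltonian Φ Λ σ = ∑' A, {A : Finset S | ¬ Disjoint A Λ}.indicator (fun A => Φ A σ) A :=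
  tsum_subtype {A : Finset S | ¬ Disjoint A Λ} fun A => Φ A σ

theorem AbsolutelySummable.summable_indicator {Φ : Interaction S} (hΦ : AbsolutelySummable Φ)
    (Λ : Finset S) :
    Summable ({A : Finset S | ¬ Disjoint A Λ}.indicator fun A => ⨆ σ : Config S, |Φ A σ|) := by
  have h0 : ∀ A, 0 ≤ ⨆ σ : Config S, |Φ A σ| := fun A => Real.iSup_nonneg fun σ => abs_nonneg _
  have h1 : ∀ i : S, Summable
      ({A : Finset S | i ∈ A}.indicator fun A => ⨆ σ : Config S, |Φ A σ|) := fun i =>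
    summable_subtype_iff_indicator.1 (hΦ i)
  refine Summable.of_nonneg_of_le (fun A => Set.indicator_nonneg (fun A _ => h0 A) A) (fun A => ?_)
    (summable_sum fun i (_ : i ∈ Λ) => h1 i)
  by_cases hA : ¬ Disjoint A Λ
  · obtain ⟨i, hiA, hiΛ⟩ := Finset.not_disjoint_iff.1 hA
    rw [Set.indicator_of_mem (by exact hA)]
    have h2 : ({A : Finset S | i ∈ A}.indicator fun A => ⨆ σ : Config S, |Φ A σ|) A =
        ⨆ σ : Config S, |Φ A σ| := Set.indicator_of_mem (by exact hiA) _
    rw [← h2]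
    exact Finset.single_le_sum
      (f := fun i => ({A : Finset S | i ∈ A}.indicator fun A => ⨆ σ : Config S, |Φ A σ|) A)
      (fun i _ => Set.indicator_nonneg (fun A _ => h0 A) A) hiΛ
  · rw [Set.indicator_of_notMem (by exact hA)]
    exact Finset.sum_nonneg fun i _ => Set.indicator_nonneg (fun A _ => h0 A) A

theorem norm_indicator_le_iSup {Φ : Interaction S}
    (hb : ∀ A, BddAbove (Set.range fun σ => |Φ A σ|)) (Λ A : Finset S) (σ : Config S) :
    ‖{A : Finset S | ¬ Disjoint A Λ}.indicator (fun A => Φ A σ) A‖ ≤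
      {A : Finset S | ¬ Disjoint A Λ}.indicator (fun A => ⨆ σ : Config S, |Φ A σ|) A := by
  rw [norm_indicator_eq_indicator_norm]
  exact Set.indicator_le_indicator (le_ciSup (hb A) σ)

theorem summable_indicator_interaction {Φ : Interaction S} (hΦ : AbsolutelySummable Φ)
    (hb : ∀ A, BddAbove (Set.range fun σ => |Φ A σ|)) (Λ : Finset S) (σ : Config S) :
    Summable ({A : Finset S | ¬ Disjoint A Λ}.indicator fun A => Φ A σ) :=
  Summable.of_norm_bounded (hΦ.summable_indicator Λ) fun A => norm_indicator_le_iSup hb Λ A σ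

theorem continuous_hamiltonian {Φ : Interaction S} (hΦ : AbsolutelySummable Φ)
    (hb : ∀ A, BddAbove (Set.range fun σ => |Φ A σ|)) (hc : ∀ A, Continuous (Φ A))
    (Λ : Finset S) : Continuous (hamiltonian Φ Λ) := by
  have h : hamiltonian Φ Λ = fun σ =>
      ∑' A, {A : Finset S | ¬ Disjoint A Λ}.indicator (fun A => Φ A σ) A :=
    funext fun σ => hamiltonian_eq_tsum_indicator Φ Λ σ
  rw [h]
  refine continuous_tsum (fun A => ?_) (hΦ.summable_indicator Λ)
    fun A σ => norm_indicator_le_iSup hb Λ A σ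
  by_cases hA : A ∈ {A : Finset S | ¬ Disjoint A Λ}
  · simpa only [Set.indicator_of_mem hA] using hc A
  · simpa only [Set.indicator_of_notMem hA] using continuous_const

/-- The energy in `Λ` only depends on the spins in the sets that meet `Λ` and interact. -/
theorem hamiltonian_congr {Φ : Interaction S} {Λ : Finset S} {σ σ' : Config S}
    (h : ∀ A, ¬ Disjoint A Λ → Φ A σ = Φ A σ') : hamiltonian Φ Λ σ = hamiltonian Φ Λ σ' :=
  tsum_congr fun A => h A.1 A.2

variable [DecidableEq S]

theorem hamiltonian_union {Φ : Interaction S} (hΦ : AbsolutelySummable Φ)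
    (hb : ∀ A, BddAbove (Set.range fun σ => |Φ A σ|)) {Λ₁ Λ₂ : Finset S} {σ : Config S}
    (h : ∀ A, ¬ Disjoint A Λ₁ → ¬ Disjoint A Λ₂ → Φ A σ = 0) :
    hamiltonian Φ (Λ₁ ∪ Λ₂) σ = hamiltonian Φ Λ₁ σ + hamiltonian Φ Λ₂ σ := by
  simp only [hamiltonian_eq_tsum_indicator]
  rw [← (summable_indicator_interaction hΦ hb Λ₁ σ).tsum_add
    (summable_indicator_interaction hΦ hb Λ₂ σ)]
  refine tsum_congr fun A => ?_
  have h' := h A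
  simp only [Set.indicator_apply, Set.mem_ofPred_eq, Finset.disjoint_union_right]
  by_cases h1 : Disjoint A Λ₁ <;> by_cases h2 : Disjoint A Λ₂ <;> simp_all

/-- The Gibbs probability, in `Λ` with boundary condition `η`, of the spins `ζ` in `Λ`. -/
def gibbsWeight (Φ : Interaction S) (Λ : Finset S) (η : Config S) (ζ : Λ → Spin) : ℝ :=
  Real.exp (-hamiltonian Φ Λ (glue Λ ζ η)) / partitionFunction Φ Λ η

theorem partitionFunction_pos (Φ : Interaction S) (Λ : Finset S) (η : Config S) :
    0 < partitionFunction Φ Λ η :=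
  Finset.sum_pos (fun _ _ => Real.exp_pos _) Finset.univ_nonempty

theorem gibbsWeight_nonneg (Φ : Interaction S) (Λ : Finset S) (η : Config S) (ζ : Λ → Spin) :
    0 ≤ gibbsWeight Φ Λ η ζ :=
  div_nonneg (Real.exp_pos _).le (partitionFunction_pos Φ Λ η).le

theorem lintegral_specification (Φ : Interaction S) (Λ : Finset S) (η : Config S)
    {g : Config S → ENNReal} (hg : Measurable g) :
    ∫⁻ σ, g σ ∂specification Φ Λ η =
      ∑ ζ : Λ → Spin, ENNReal.ofReal (gibbsWeight Φ Λ η ζ) * g (glue Λ ζ η) := by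
  simp only [specification, lintegral_finsetSum_measure, lintegral_smul_measure,
    lintegral_dirac' _ hg, smul_eq_mul, gibbsWeight]

theorem specification_apply (Φ : Interaction S) (Λ : Finset S) (η : Config S)
    {E : Set (Config S)} (hE : MeasurableSet E) :
    specification Φ Λ η E = ∑ ζ : Λ → Spin,
      ENNReal.ofReal (gibbsWeight Φ Λ η ζ) * E.indicator 1 (glue Λ ζ η) := by
  rw [← lintegral_indicator_one hE, lintegral_specification Φ Λ η (measurable_one.indicator hE)]

theorem measurable_glue (Λ : Finset S) (ζ : Λ → Spin) : Measurable (glue Λ ζ) := by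
  refine measurable_pi_lambda _ fun i => ?_
  by_cases h : i ∈ Λ
  · simp only [glue, h, dite_true, measurable_const]
  · simp only [glue, h, dite_false]
    exact measurable_pi_apply i

theorem measurable_gibbsWeight {Φ : Interaction S} (hm : ∀ Λ, Measurable (hamiltonian Φ Λ))
    (Λ : Finset S) (ζ : Λ → Spin) : Measurable fun η => gibbsWeight Φ Λ η ζ := by
  have h : ∀ ζ : Λ → Spin, Measurable fun η => Real.exp (-hamiltonian Φ Λ (glue Λ ζ η)) :=
    fun ζ => Real.measurable_exp.comp ((hm Λ).comp (measurable_glue Λ ζ)).neg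
  exact (h ζ).div (Finset.measurable_sum _ fun ζ _ => h ζ)

theorem measurable_specification {Φ : Interaction S} (hm : ∀ Λ, Measurable (hamiltonian Φ Λ))
    (Λ : Finset S) : Measurable (specification Φ Λ) := by
  refine Measure.measurable_of_measurable_coe _ fun E hE => ?_
  simp only [specification_apply Φ Λ _ hE]
  exact Finset.measurable_sum _ fun ζ _ =>
    (measurable_gibbsWeight hm Λ ζ).ennreal_ofReal.mul
      ((measurable_one.indicator hE).comp (measurable_glue Λ ζ))

theorem isGibbs_iff_bind {Φ : Interaction S} (hm : ∀ Λ, Measurable (hamiltonian Φ Λ))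
    {μ : Measure (Config S)} [hμ : IsProbabilityMeasure μ] :
    IsGibbs Φ μ ↔ ∀ Λ, μ.bind (specification Φ Λ) = μ := by
  constructor
  · intro h Λ
    ext E hE
    rw [Measure.bind_apply hE (measurable_specification hm Λ).aemeasurable, h.dlr Λ E hE]
  · intro h
    refine ⟨hμ, fun Λ E hE => ?_⟩
    rw [← Measure.bind_apply hE (measurable_specification hm Λ).aemeasurable, h Λ]

theorem specification_empty (Φ : Interaction S) (η : Config S) :
    specification Φ ∅ η = Measure.dirac η := by
  have hg : ∀ ζ : (∅ : Finset S) → Spin, glue ∅ ζ η = η := fun ζ => by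
    funext i
    simp [glue]
  simp only [specification, partitionFunction, hg]
  simp

/-- If the energies in the disjoint sets `Λ₁` and `Λ₂` do not see each other, then resampling the
spins in `Λ₁ ∪ Λ₂` amounts to resampling first those in `Λ₁`, then those in `Λ₂`. -/
theorem specification_union {Φ : Interaction S} (hm : ∀ Λ, Measurable (hamiltonian Φ Λ))
    {Λ₁ Λ₂ : Finset S} (hdisj : Disjoint Λ₁ Λ₂)
    (hH : ∀ σ, hamiltonian Φ (Λ₁ ∪ Λ₂) σ = hamiltonian Φ Λ₁ σ + hamiltonian Φ Λ₂ σ)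
    (h1 : ∀ σ σ' : Config S, (∀ i, i ∉ Λ₂ → σ i = σ' i) →
      hamiltonian Φ Λ₁ σ = hamiltonian Φ Λ₁ σ')
    (h2 : ∀ σ σ' : Config S, (∀ i, i ∉ Λ₁ → σ i = σ' i) →
      hamiltonian Φ Λ₂ σ = hamiltonian Φ Λ₂ σ') (η : Config S) :
    specification Φ (Λ₁ ∪ Λ₂) η = (specification Φ Λ₁ η).bind (specification Φ Λ₂) := by
  let e : ((Λ₁ ∪ Λ₂ : Finset S) → Spin) ≃ (Λ₁ → Spin) × (Λ₂ → Spin) :=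
    (Equiv.arrowCongr (Equiv.Finset.union Λ₁ Λ₂ hdisj).symm (Equiv.refl _)).trans
      (Equiv.sumArrowEquivProdArrow _ _ _)
  have e1 : ∀ ζ i (hi : i ∈ Λ₁),
      (e ζ).1 ⟨i, hi⟩ = ζ ⟨i, Finset.mem_union_left _ hi⟩ := fun ζ i hi => rfl
  have e2 : ∀ ζ i (hi : i ∈ Λ₂),
      (e ζ).2 ⟨i, hi⟩ = ζ ⟨i, Finset.mem_union_right _ hi⟩ := fun ζ i hi => rfl
  have hglue : ∀ ζ, glue (Λ₁ ∪ Λ₂) ζ η = glue Λ₂ (e ζ).2 (glue Λ₁ (e ζ).1 η) := by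
    intro ζ
    funext i
    by_cases hi2 : i ∈ Λ₂
    · simp [glue, hi2, e2]
    · by_cases hi1 : i ∈ Λ₁
      · simp [glue, hi2, hi1, e1]
      · simp [glue, hi2, hi1]
  have hH1 : ∀ ζ₁ ζ₂, hamiltonian Φ Λ₁ (glue Λ₂ ζ₂ (glue Λ₁ ζ₁ η)) =
      hamiltonian Φ Λ₁ (glue Λ₁ ζ₁ η) := fun ζ₁ ζ₂ => h1 _ _ fun i hi => by simp [glue, hi]
  have hH2 : ∀ ζ₁ ζ₂, hamiltonian Φ Λ₂ (glue Λ₂ ζ₂ (glue Λ₁ ζ₁ η)) =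
      hamiltonian Φ Λ₂ (glue Λ₂ ζ₂ η) := fun ζ₁ ζ₂ => h2 _ _ fun i hi => by simp [glue, hi]
  have hZ2 : ∀ ζ₁, partitionFunction Φ Λ₂ (glue Λ₁ ζ₁ η) = partitionFunction Φ Λ₂ η :=
    fun ζ₁ => Finset.sum_congr rfl fun ζ₂ _ => by rw [hH2]
  have hZ : partitionFunction Φ (Λ₁ ∪ Λ₂) η =
      partitionFunction Φ Λ₁ η * partitionFunction Φ Λ₂ η := by
    simp only [partitionFunction]
    rw [Finset.sum_mul_sum, ← Finset.sum_product', Finset.univ_product_univ]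
    refine Fintype.sum_equiv e _ _ fun ζ => ?_
    rw [hH, hglue, hH1, hH2, ← Real.exp_add]
    ring_nf
  have hw : ∀ ζ, gibbsWeight Φ (Λ₁ ∪ Λ₂) η ζ =
      gibbsWeight Φ Λ₁ η (e ζ).1 * gibbsWeight Φ Λ₂ (glue Λ₁ (e ζ).1 η) (e ζ).2 := by
    intro ζ
    simp only [gibbsWeight]
    rw [hH, hglue, hH1, hZ2, hZ, neg_add, Real.exp_add, mul_div_mul_comm]
  ext E hE
  rw [Measure.bind_apply hE (measurable_specification hm Λ₂).aemeasurable,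
    lintegral_specification Φ Λ₁ η (g := fun a => specification Φ Λ₂ a E)
      ((Measure.measurable_coe hE).comp (measurable_specification hm Λ₂)),
    specification_apply _ _ _ hE]
  simp only [specification_apply _ _ _ hE, Finset.mul_sum]
  rw [← Finset.sum_product', Finset.univ_product_univ]
  refine Fintype.sum_equiv e _ _ fun ζ => ?_
  rw [hw, hglue, ENNReal.ofReal_mul (gibbsWeight_nonneg _ _ _ _), mul_assoc]

end Specification

/-! ### The multiplicative potential, layer by layer -/

section Layers

variable {d : ℕ} {p : Fin d → ℕ} {𝒜 : Set (Finset ℕ+)} {J : Finset ℕ+ → ℝ}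

theorem prime_of_range_eq_basePrimes (hprimes : Set.range p = basePrimes 𝒜) (i : Fin d) :
    (p i).Prime := by
  have : p i ∈ basePrimes 𝒜 := hprimes ▸ Set.mem_range_self i
  exact this.1

theorem site_mul (hp : ∀ i, (p i).Prime) (hinj : Function.Injective p)
    (hprimes : Set.range p = basePrimes 𝒜) {A : Finset ℕ+} (hA : A ∈ 𝒜) {n : ℕ+} (hn : n ∈ A)
    (r : layerIndices p) (x : LayerSite d) :
    site p r x * n = site p r (x + exponents p n) := by
  refine PNat.eq ?_
  rw [PNat.mul_coe, site_add hp, primePower_exponents hinj fun q hq hqn => ?_]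
  rw [hprimes]
  exact ⟨hq, A, hA, n, hn, hqn⟩

theorem dilate_site (hp : ∀ i, (p i).Prime) (hinj : Function.Injective p)
    (hprimes : Set.range p = basePrimes 𝒜) {A : Finset ℕ+} (hA : A ∈ 𝒜)
    (r : layerIndices p) (x : LayerSite d) :
    dilate (site p r x) A = (translate x (A.image (exponents p))).image (site p r) := by
  unfold translate dilate
  rw [Finset.image_image, Finset.image_image]
  exact Finset.image_congr fun n hn => site_mul hp hinj hprimes hA hn r x

/-- On sets inside a layer, the multiplicative potential is the layer potential. -/
theorem multPotential_image_site (h𝒜 : ∀ A ∈ 𝒜, A.Nonempty) (hJ : Consistent 𝒜 J)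
    (hinj : Function.Injective p) (hprimes : Set.range p = basePrimes 𝒜)
    (r : layerIndices p) (C : Finset (LayerSite d)) (σ : Config ℕ+) :
    multPotential 𝒜 J (C.image (site p r)) σ = layerPotential p 𝒜 J C (layer p r σ) := by
  have hp := prime_of_range_eq_basePrimes hprimes
  by_cases h : ∃ A ∈ 𝒜, ∃ x : LayerSite d, C = translate x (A.image (exponents p))
  · obtain ⟨A, hA, x, rfl⟩ := h
    rw [← dilate_site hp hinj hprimes hA, multPotential_dilate hJ hA,
      layerPotential_translate hJ hinj hprimes hA]
    congr 1
    refine Finset.prod_congr rfl fun n hn => ?_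
    simp only [multShift, layerShift, layer, site_mul hp hinj hprimes hA hn]
  · rw [layerPotential_eq_zero h, multPotential_eq_zero]
    rintro ⟨A, hA, i, hi⟩
    obtain ⟨⟨s, x⟩, rfl⟩ := site_surjective hp hinj i
    dsimp only at hi
    rw [dilate_site hp hinj hprimes hA] at hi
    obtain ⟨n, hn⟩ := h𝒜 A hA
    have hmem : site p s (x + exponents p n) ∈ C.image (site p r) := by
      rw [hi]
      exact Finset.mem_image_of_mem _
        (Finset.mem_image_of_mem _ (Finset.mem_image_of_mem _ hn))
    obtain ⟨y, _, hy⟩ := Finset.mem_image.1 hmem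
    have hrs : r = s := congrArg Prod.fst (@site_injective d p hp hinj (r, y) (s, _) hy)
    subst hrs
    exact h ⟨A, hA, x, Finset.image_injective (site_right_injective hp hinj r) hi⟩

/-- Only sets contained in a single layer interact. -/
theorem exists_image_site_of_multPotential_ne_zero (hinj : Function.Injective p)
    (hprimes : Set.range p = basePrimes 𝒜) {B : Finset ℕ+} {σ : Config ℕ+}
    (h : multPotential 𝒜 J B σ ≠ 0) :
    ∃ (r : layerIndices p) (C : Finset (LayerSite d)), B = C.image (site p r) := by
  have hp := prime_of_range_eq_basePrimes hprimes
  by_contra hB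
  refine h (multPotential_eq_zero ?_ σ)
  rintro ⟨A, hA, i, rfl⟩
  obtain ⟨⟨r, x⟩, rfl⟩ := site_surjective hp hinj i
  exact hB ⟨r, _, dilate_site hp hinj hprimes hA r x⟩

theorem multPotential_congr (B : Finset ℕ+) {σ σ' : Config ℕ+} (h : ∀ n ∈ B, σ n = σ' n) :
    multPotential 𝒜 J B σ = multPotential 𝒜 J B σ' := by
  unfold multPotential
  split_ifs
  · rw [Finset.prod_congr rfl fun n hn => by rw [h n hn]]
  · rfl

theorem continuous_multPotential (B : Finset ℕ+) : Continuous (multPotential 𝒜 J B) := by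
  unfold multPotential
  split_ifs
  · exact continuous_const.mul (continuous_finsetProd _ fun n _ =>
      (continuous_of_discreteTopology (f := Spin.val)).comp (continuous_apply n))
  · exact continuous_const

theorem bddAbove_multPotential (B : Finset ℕ+) :
    BddAbove (Set.range fun σ => |multPotential 𝒜 J B σ|) :=
  (isCompact_range (continuous_multPotential B).abs).bddAbove

theorem measurable_hamiltonian_multPotential
    (hU : AbsolutelySummable (multPotential 𝒜 J)) (Λ : Finset ℕ+) :
    Measurable (hamiltonian (multPotential 𝒜 J) Λ) :=
  (continuous_hamiltonian hU bddAbove_multPotential continuous_multPotential Λ).measurable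

theorem hamiltonian_image_site (h𝒜 : ∀ A ∈ 𝒜, A.Nonempty) (hJ : Consistent 𝒜 J)
    (hinj : Function.Injective p) (hprimes : Set.range p = basePrimes 𝒜)
    (r : layerIndices p) (Λ : Finset (LayerSite d)) (σ : Config ℕ+) :
    hamiltonian (multPotential 𝒜 J) (Λ.image (site p r)) σ =
      hamiltonian (layerPotential p 𝒜 J) Λ (layer p r σ) := by
  have hp := prime_of_range_eq_basePrimes hprimes
  have hs := site_right_injective hp hinj r
  have hd : ∀ C : Finset (LayerSite d),
      Disjoint (C.image (site p r)) (Λ.image (site p r)) ↔ Disjoint C Λ := fun C =>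
    Finset.disjoint_image hs
  let φ : {C : Finset (LayerSite d) // ¬ Disjoint C Λ} →
      {B : Finset ℕ+ // ¬ Disjoint B (Λ.image (site p r))} :=
    fun C => ⟨C.1.image (site p r), fun h => C.2 ((hd _).1 h)⟩
  have hφ : Function.Injective φ := fun C C' h =>
    Subtype.ext (Finset.image_injective hs (congrArg Subtype.val h))
  unfold hamiltonian
  rw [← hφ.tsum_eq (f := fun B : {B : Finset ℕ+ // ¬ Disjoint B (Λ.image (site p r))} =>
    multPotential 𝒜 J B.1 σ)]
  · exact tsum_congr fun C => multPotential_image_site h𝒜 hJ hinj hprimes r C.1 σ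
  · rintro ⟨B, hB⟩ hne
    obtain ⟨s, C, rfl⟩ := exists_image_site_of_multPotential_ne_zero hinj hprimes
      (Function.mem_support.1 hne)
    obtain ⟨n, hn, hn'⟩ := Finset.not_disjoint_iff.1 hB
    obtain ⟨x, _, rfl⟩ := Finset.mem_image.1 hn
    obtain ⟨y, _, hy⟩ := Finset.mem_image.1 hn'
    have hrs : r = s := congrArg Prod.fst (@site_injective d p hp hinj (r, y) (s, x) hy)
    subst hrs
    exact ⟨⟨C, fun h => hB ((hd _).2 h)⟩, rfl⟩

theorem measurable_hamiltonian_layerPotential (h𝒜 : ∀ A ∈ 𝒜, A.Nonempty)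
    (hJ : Consistent 𝒜 J) (hU : AbsolutelySummable (multPotential 𝒜 J))
    (hinj : Function.Injective p) (hprimes : Set.range p = basePrimes 𝒜)
    (Λ : Finset (LayerSite d)) : Measurable (hamiltonian (layerPotential p 𝒜 J) Λ) := by
  have hp := prime_of_range_eq_basePrimes hprimes
  -- a configuration of one layer extends measurably to all of `ℕ`
  have hr : 1 ∈ layerIndices p := ⟨le_rfl, fun i h => (hp i).one_lt.ne' (Nat.dvd_one.1 h)⟩
  let ext : Config (LayerSite d) → Config ℕ+ := fun τ n => τ (exponents p n)
  have hext : Measurable ext := measurable_pi_lambda _ fun n => measurable_pi_apply _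
  have hl : ∀ τ, layer p ⟨1, hr⟩ (ext τ) = τ := fun τ => by
    funext x
    simp only [layer, ext, exponents_site hp hinj]
  have h : hamiltonian (layerPotential p 𝒜 J) Λ =
      fun τ => hamiltonian (multPotential 𝒜 J) (Λ.image (site p ⟨1, hr⟩)) (ext τ) := by
    funext τ
    rw [hamiltonian_image_site h𝒜 hJ hinj hprimes, hl]
  rw [h]
  exact (measurable_hamiltonian_multPotential hU _).comp hext

/-- Resampling spins in a single layer does not affect the other layers, and follows the
Gibbs distribution of the layer potential. -/
theorem specification_image_site (h𝒜 : ∀ A ∈ 𝒜, A.Nonempty) (hJ : Consistent 𝒜 J)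
    (hinj : Function.Injective p) (hprimes : Set.range p = basePrimes 𝒜)
    (r : layerIndices p) (Λ : Finset (LayerSite d)) (η : Config ℕ+)
    {B : Set (Config ℕ+)} (hB : MeasurableSet B)
    (hBr : ∀ σ σ' : Config ℕ+, (∀ n, n ∉ Set.range (site p r) → σ n = σ' n) → σ ∈ B → σ' ∈ B)
    {E : Set (Config (LayerSite d))} (hE : MeasurableSet E) :
    specification (multPotential 𝒜 J) (Λ.image (site p r)) η (B ∩ layer p r ⁻¹' E) =
      B.indicator (fun η => specification (layerPotential p 𝒜 J) Λ (layer p r η) E) η := by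
  have hp := prime_of_range_eq_basePrimes hprimes
  have hs := site_right_injective hp hinj r
  let e₀ : Λ ≃ (Λ.image (site p r) : Finset ℕ+) :=
    Equiv.ofBijective (fun x => ⟨site p r x, Finset.mem_image_of_mem _ x.2⟩)
      ⟨fun x y h => Subtype.ext (hs (congrArg Subtype.val h)), fun n => by
        obtain ⟨x, hx, hxn⟩ := Finset.mem_image.1 n.2
        exact ⟨⟨x, hx⟩, Subtype.ext hxn⟩⟩
  let e : ((Λ.image (site p r) : Finset ℕ+) → Spin) ≃ (Λ → Spin) :=
    Equiv.arrowCongr e₀.symm (Equiv.refl _)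
  have he : ∀ ζ x (hx : x ∈ Λ), e ζ ⟨x, hx⟩ = ζ ⟨site p r x, Finset.mem_image_of_mem _ hx⟩ :=
    fun ζ x hx => rfl
  have hlay : ∀ ζ, layer p r (glue (Λ.image (site p r)) ζ η) = glue Λ (e ζ) (layer p r η) := by
    intro ζ
    funext x
    by_cases hx : x ∈ Λ
    · have hx' : site p r x ∈ Λ.image (site p r) := Finset.mem_image_of_mem _ hx
      simp only [layer, glue, dif_pos hx, dif_pos hx', he]
    · have hx' : site p r x ∉ Λ.image (site p r) := fun h => by
        obtain ⟨y, hy, hyx⟩ := Finset.mem_image.1 h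
        exact hx (hs hyx ▸ hy)
      simp only [layer, glue, dif_neg hx, dif_neg hx']
  have hoff : ∀ ζ n, n ∉ Set.range (site p r) → glue (Λ.image (site p r)) ζ η n = η n := by
    intro ζ n hn
    have : n ∉ Λ.image (site p r) := fun h => by
      obtain ⟨y, _, hy⟩ := Finset.mem_image.1 h
      exact hn ⟨y, hy⟩
    simp only [glue, dif_neg this]
  have hZ : partitionFunction (multPotential 𝒜 J) (Λ.image (site p r)) η =
      partitionFunction (layerPotential p 𝒜 J) Λ (layer p r η) :=
    Fintype.sum_equiv e _ _ fun ζ => by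
      rw [hamiltonian_image_site h𝒜 hJ hinj hprimes, hlay]
  have hw : ∀ ζ, gibbsWeight (multPotential 𝒜 J) (Λ.image (site p r)) η ζ =
      gibbsWeight (layerPotential p 𝒜 J) Λ (layer p r η) (e ζ) := fun ζ => by
    simp only [gibbsWeight]
    rw [hZ, hamiltonian_image_site h𝒜 hJ hinj hprimes, hlay]
  rw [specification_apply _ _ _ (hB.inter (measurable_layer r hE))]
  by_cases hη : η ∈ B
  · rw [Set.indicator_of_mem hη, specification_apply _ _ _ hE]
    refine Fintype.sum_equiv e _ _ fun ζ => ?_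
    have hmem : glue (Λ.image (site p r)) ζ η ∈ B := hBr _ _ (fun n hn => (hoff ζ n hn).symm) hη
    have hind : (B ∩ layer p r ⁻¹' E).indicator (1 : Config ℕ+ → ENNReal)
        (glue (Λ.image (site p r)) ζ η) =
        E.indicator 1 (layer p r (glue (Λ.image (site p r)) ζ η)) := by
      by_cases hE' : layer p r (glue (Λ.image (site p r)) ζ η) ∈ E
      · rw [Set.indicator_of_mem hE', Set.indicator_of_mem
          (show _ ∈ B ∩ layer p r ⁻¹' E from ⟨hmem, hE'⟩)]
        rfl
      · rw [Set.indicator_of_notMem hE', Set.indicator_of_notMem fun h => hE' h.2]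
    rw [hw, hind, hlay]
  · rw [Set.indicator_of_notMem hη]
    refine Finset.sum_eq_zero fun ζ _ => ?_
    have hmem : glue (Λ.image (site p r)) ζ η ∉ B := fun h =>
      hη (hBr _ _ (hoff ζ) h)
    rw [Set.indicator_of_notMem (fun h => hmem h.1), mul_zero]

/-- The integrated form of `specification_image_site`: a law on all configurations, conditioned on
what happens off a layer, is resampled within the layer by the layer specification. -/
theorem bind_specification_image_site (h𝒜 : ∀ A ∈ 𝒜, A.Nonempty) (hJ : Consistent 𝒜 J)
    (hU : AbsolutelySummable (multPotential 𝒜 J))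
    (hinj : Function.Injective p) (hprimes : Set.range p = basePrimes 𝒜)
    (r : layerIndices p) (Λ : Finset (LayerSite d)) (ν : Measure (Config ℕ+))
    {B : Set (Config ℕ+)} (hB : MeasurableSet B)
    (hBr : ∀ σ σ' : Config ℕ+, (∀ n, n ∉ Set.range (site p r) → σ n = σ' n) → σ ∈ B → σ' ∈ B)
    {E : Set (Config (LayerSite d))} (hE : MeasurableSet E) :
    ν.bind (specification (multPotential 𝒜 J) (Λ.image (site p r))) (B ∩ layer p r ⁻¹' E) =
      ∫⁻ τ, specification (layerPotential p 𝒜 J) Λ τ E ∂(ν.restrict B).map (layer p r) := by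
  have hmV := measurable_hamiltonian_layerPotential h𝒜 hJ hU hinj hprimes
  rw [Measure.bind_apply (hB.inter (measurable_layer r hE))
    (measurable_specification (measurable_hamiltonian_multPotential hU) _).aemeasurable,
    lintegral_map (f := fun τ => specification (layerPotential p 𝒜 J) Λ τ E)
      ((Measure.measurable_coe hE).comp (measurable_specification hmV Λ))
      (measurable_layer r), ← lintegral_indicator hB]
  exact lintegral_congr fun η =>
    specification_image_site h𝒜 hJ hinj hprimes r Λ η hB hBr hE

end Layers

/-! ### The Gibbs measure of the multiplicative potential -/

section Product

variable {d : ℕ} {p : Fin d → ℕ}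

/-- The law on `{-1, 1}^ℕ` under which the layers are independent with common law `μ`. -/
def layerProduct (hp : ∀ i, (p i).Prime) (hinj : Function.Injective p)
    (μ : Measure (Config (LayerSite d))) [IsProbabilityMeasure μ] : Measure (Config ℕ+) :=
  (Measure.infinitePi fun _ : layerIndices p => μ).map (layersEquiv hp hinj).symm

/-- The event that for `r ∈ s` the restriction to the layer `r` lies in `t r`. -/
def layerCylinder (p : Fin d → ℕ) (s : Finset (layerIndices p))
    (t : layerIndices p → Set (Config (LayerSite d))) : Set (Config ℕ+) :=
  {σ | ∀ r ∈ s, layer p r σ ∈ t r}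

theorem preimage_layersEquiv (hp : ∀ i, (p i).Prime) (hinj : Function.Injective p)
    (s : Finset (layerIndices p)) (t : layerIndices p → Set (Config (LayerSite d))) :
    layersEquiv hp hinj ⁻¹' Set.pi s t = layerCylinder p s t := rfl

theorem measurableSet_layerCylinder (s : Finset (layerIndices p))
    {t : layerIndices p → Set (Config (LayerSite d))} (ht : ∀ r, MeasurableSet (t r)) :
    MeasurableSet (layerCylinder p s t) := by
  have h : layerCylinder p s t = ⋂ r ∈ s, layer p r ⁻¹' t r := by
    ext σ
    simp [layerCylinder]
  rw [h]
  exact Finset.measurableSet_biInter s fun r _ => measurable_layer r (ht r)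

theorem layerCylinder_insert (s : Finset (layerIndices p)) [DecidableEq (layerIndices p)]
    (t : layerIndices p → Set (Config (LayerSite d))) (r : layerIndices p) :
    layerCylinder p (insert r s) t = layerCylinder p s t ∩ layer p r ⁻¹' t r := by
  ext σ
  simp [layerCylinder, and_comm]

/-- A cylinder that does not constrain the layer `r` is an event off that layer. -/
theorem mem_layerCylinder_congr (hp : ∀ i, (p i).Prime) (hinj : Function.Injective p)
    {s : Finset (layerIndices p)} {t : layerIndices p → Set (Config (LayerSite d))}
    {r : layerIndices p} (hr : r ∉ s) (σ σ' : Config ℕ+)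
    (h : ∀ n, n ∉ Set.range (site p r) → σ n = σ' n) (hσ : σ ∈ layerCylinder p s t) :
    σ' ∈ layerCylinder p s t := by
  intro q hq
  have hqσ : layer p q σ = layer p q σ' := by
    funext x
    refine h _ ?_
    rintro ⟨y, hy⟩
    have hrq : r = q := congrArg Prod.fst (@site_injective d p hp hinj (r, y) (q, x) hy)
    exact hr (hrq ▸ hq)
  rw [← hqσ]
  exact hσ q hq

instance (hp : ∀ i, (p i).Prime) (hinj : Function.Injective p)
    (μ : Measure (Config (LayerSite d))) [IsProbabilityMeasure μ] :
    IsProbabilityMeasure (layerProduct hp hinj μ) :=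
  Measure.isProbabilityMeasure_map (layersEquiv hp hinj).symm.measurable.aemeasurable

theorem map_layersEquiv_layerProduct (hp : ∀ i, (p i).Prime) (hinj : Function.Injective p)
    (μ : Measure (Config (LayerSite d))) [IsProbabilityMeasure μ] :
    (layerProduct hp hinj μ).map (layersEquiv hp hinj) =
      Measure.infinitePi fun _ : layerIndices p => μ :=
  (layersEquiv hp hinj).map_map_symm

theorem layerProduct_layerCylinder (hp : ∀ i, (p i).Prime) (hinj : Function.Injective p)
    (μ : Measure (Config (LayerSite d))) [IsProbabilityMeasure μ]
    (s : Finset (layerIndices p)) {t : layerIndices p → Set (Config (LayerSite d))}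
    (ht : ∀ r, MeasurableSet (t r)) :
    layerProduct hp hinj μ (layerCylinder p s t) = ∏ r ∈ s, μ (t r) := by
  rw [← preimage_layersEquiv hp hinj, ← MeasurableEquiv.map_apply,
    map_layersEquiv_layerProduct hp hinj, Measure.infinitePi_pi _ fun r _ => ht r]

theorem eq_layerProduct (hp : ∀ i, (p i).Prime) (hinj : Function.Injective p)
    (μ : Measure (Config (LayerSite d))) [IsProbabilityMeasure μ] {ν : Measure (Config ℕ+)}
    (h : ∀ (s : Finset (layerIndices p)) (t : layerIndices p → Set (Config (LayerSite d))),
      (∀ r, MeasurableSet (t r)) → ν (layerCylinder p s t) = ∏ r ∈ s, μ (t r)) :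
    ν = layerProduct hp hinj μ := by
  have h1 : ν.map (layersEquiv hp hinj) = Measure.infinitePi fun _ : layerIndices p => μ := by
    refine Measure.eq_infinitePi _ fun s t ht => ?_
    rw [MeasurableEquiv.map_apply, preimage_layersEquiv, h s t ht]
  rw [layerProduct, ← h1, MeasurableEquiv.map_symm_map]

end Product

section Gibbs

variable {d : ℕ} {p : Fin d → ℕ} {𝒜 : Set (Finset ℕ+)} {J : Finset ℕ+ → ℝ}

/-- The product law is preserved by resampling in one layer, as is seen on cylinders. -/
theorem layerProduct_bind_image_site (h𝒜 : ∀ A ∈ 𝒜, A.Nonempty) (hJ : Consistent 𝒜 J)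
    (hU : AbsolutelySummable (multPotential 𝒜 J))
    (hinj : Function.Injective p) (hprimes : Set.range p = basePrimes 𝒜)
    {μ : Measure (Config (LayerSite d))} [IsProbabilityMeasure μ]
    (hμ : IsGibbs (layerPotential p 𝒜 J) μ) (r : layerIndices p) (Λ : Finset (LayerSite d)) :
    (layerProduct (prime_of_range_eq_basePrimes hprimes) hinj μ).bind
        (specification (multPotential 𝒜 J) (Λ.image (site p r))) =
      layerProduct (prime_of_range_eq_basePrimes hprimes) hinj μ := by
  classical
  have hp := prime_of_range_eq_basePrimes hprimes
  refine eq_layerProduct hp hinj μ fun s t ht => ?_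
  -- split off the constraint on the layer `r`
  let E : Set (Config (LayerSite d)) := if r ∈ s then t r else Set.univ
  have hE : MeasurableSet E := by
    by_cases h : r ∈ s
    · simpa only [E, if_pos h] using ht r
    · simp only [E, if_neg h, MeasurableSet.univ]
  have hset : layerCylinder p s t = layerCylinder p (s.erase r) t ∩ layer p r ⁻¹' E := by
    by_cases h : r ∈ s
    · simp only [E, if_pos h]
      rw [← layerCylinder_insert, Finset.insert_erase h]
    · simp only [E, if_neg h, Set.preimage_univ, Set.inter_univ, Finset.erase_eq_of_notMem h]
  have hind : ∀ F : Set (Config (LayerSite d)), MeasurableSet F →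
      layerProduct hp hinj μ (layerCylinder p (s.erase r) t ∩ layer p r ⁻¹' F) =
        (∏ q ∈ s.erase r, μ (t q)) * μ F := by
    intro F hF
    have h1 : layerCylinder p (s.erase r) t ∩ layer p r ⁻¹' F =
        layerCylinder p (insert r (s.erase r)) (Function.update t r F) := by
      rw [layerCylinder_insert, Function.update_self]
      congr 1
      ext σ
      refine forall₂_congr fun q hq => ?_
      rw [Function.update_of_ne (Finset.ne_of_mem_erase hq)]
    rw [h1, layerProduct_layerCylinder hp hinj μ _ fun q => ?_,
      Finset.prod_insert (Finset.notMem_erase r s), Function.update_self, mul_comm]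
    · congr 1
      exact Finset.prod_congr rfl fun q hq => by
        rw [Function.update_of_ne (Finset.ne_of_mem_erase hq)]
    · by_cases hq : q = r
      · subst hq
        rwa [Function.update_self]
      · rw [Function.update_of_ne hq]
        exact ht q
  have hB := measurableSet_layerCylinder (p := p) (s.erase r) ht
  have hmap : ((layerProduct hp hinj μ).restrict (layerCylinder p (s.erase r) t)).map
      (layer p r) = (∏ q ∈ s.erase r, μ (t q)) • μ := by
    ext F hF
    rw [Measure.map_apply (measurable_layer r) hF, Measure.restrict_apply (measurable_layer r hF),
      Set.inter_comm, hind F hF]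
    rfl
  rw [hset, bind_specification_image_site h𝒜 hJ hU hinj hprimes r Λ _ hB
    (mem_layerCylinder_congr hp hinj (Finset.notMem_erase r s)) hE, hmap, lintegral_smul_measure,
    hμ.dlr Λ E hE, smul_eq_mul]
  by_cases h : r ∈ s
  · simp only [E, if_pos h]
    rw [mul_comm, Finset.mul_prod_erase s (fun q => μ (t q)) h]
  · simp only [E, if_neg h, measure_univ, mul_one, Finset.erase_eq_of_notMem h]

theorem layerProduct_isGibbs (h𝒜 : ∀ A ∈ 𝒜, A.Nonempty) (hJ : Consistent 𝒜 J)
    (hU : AbsolutelySummable (multPotential 𝒜 J))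
    (hinj : Function.Injective p) (hprimes : Set.range p = basePrimes 𝒜)
    {μ : Measure (Config (LayerSite d))} [IsProbabilityMeasure μ]
    (hμ : IsGibbs (layerPotential p 𝒜 J) μ) :
    IsGibbs (multPotential 𝒜 J)
      (layerProduct (prime_of_range_eq_basePrimes hprimes) hinj μ) := by
  classical
  have hp := prime_of_range_eq_basePrimes hprimes
  have hm := measurable_hamiltonian_multPotential hU
  rw [isGibbs_iff_bind hm]
  -- a potential term is determined by the spins in the layer that contains the interacting set
  have hcongr : ∀ (A : Finset ℕ+) (σ σ' : Config ℕ+),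
      (∀ (q : layerIndices p) (C : Finset (LayerSite d)), A = C.image (site p q) →
        ∀ n ∈ A, σ n = σ' n) → multPotential 𝒜 J A σ = multPotential 𝒜 J A σ' := by
    intro A σ σ' h
    by_cases h0 : multPotential 𝒜 J A σ = 0 ∧ multPotential 𝒜 J A σ' = 0
    · rw [h0.1, h0.2]
    · obtain ⟨q, C, hA⟩ : ∃ (q : layerIndices p) (C : Finset (LayerSite d)),
          A = C.image (site p q) := by
        rcases not_and_or.1 h0 with h0 | h0 <;>
          exact exists_image_site_of_multPotential_ne_zero hinj hprimes h0
      exact multPotential_congr A (h q C hA)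
  have hlayer : ∀ {q r : layerIndices p} {C : Finset (LayerSite d)} {n : ℕ+} {x : LayerSite d},
      n ∈ C.image (site p q) → site p r x = n → q = r := by
    intro q r C n x hn hx
    obtain ⟨y, _, hy⟩ := Finset.mem_image.1 hn
    exact congrArg Prod.fst (@site_injective d p hp hinj (q, y) (r, x) (hy.trans hx.symm))
  have hall : ∀ (R : Finset (layerIndices p)) (Λs : layerIndices p → Finset (LayerSite d)),
      (layerProduct hp hinj μ).bind
        (specification (multPotential 𝒜 J) (R.biUnion fun r => (Λs r).image (site p r))) =
      layerProduct hp hinj μ := by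
    intro R Λs
    induction R using Finset.induction_on with
    | empty =>
      have h : specification (multPotential 𝒜 J) ∅ = Measure.dirac :=
        funext fun η => specification_empty _ η
      rw [Finset.biUnion_empty, h, Measure.bind_dirac]
    | insert r R hr ih =>
      have hmem : ∀ {n}, n ∈ R.biUnion (fun r => (Λs r).image (site p r)) →
          ∃ q ∈ R, ∃ x, site p q x = n := by
        intro n hn
        obtain ⟨q, hq, hn⟩ := Finset.mem_biUnion.1 hn
        obtain ⟨x, _, hx⟩ := Finset.mem_image.1 hn
        exact ⟨q, hq, x, hx⟩
      have hunion := fun η => specification_union (Φ := multPotential 𝒜 J) hm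
        (Λ₁ := (Λs r).image (site p r)) (Λ₂ := R.biUnion fun r => (Λs r).image (site p r))
        (by
          refine Finset.disjoint_left.2 fun n hn hn' => hr ?_
          obtain ⟨q, hq, x, hx⟩ := hmem hn'
          exact hlayer hn hx ▸ hq)
        (fun σ => hamiltonian_union hU bddAbove_multPotential fun A h1 h2 => by
          by_contra h0
          obtain ⟨q, C, rfl⟩ := exists_image_site_of_multPotential_ne_zero hinj hprimes h0
          obtain ⟨n, hn, hn1⟩ := Finset.not_disjoint_iff.1 h1
          obtain ⟨m, hm, hm2⟩ := Finset.not_disjoint_iff.1 h2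
          obtain ⟨x, _, hx⟩ := Finset.mem_image.1 hn1
          obtain ⟨q', hq', y, hy⟩ := hmem hm2
          exact hr (hlayer hn hx ▸ hlayer hm hy ▸ hq'))
        (fun σ σ' hσ => hamiltonian_congr fun A h1 => hcongr A σ σ' fun q C hA n hn => by
          subst hA
          obtain ⟨m, hm, hm1⟩ := Finset.not_disjoint_iff.1 h1
          obtain ⟨x, _, hx⟩ := Finset.mem_image.1 hm1
          refine hσ n fun hn2 => hr ?_
          obtain ⟨q', hq', y, hy⟩ := hmem hn2
          exact hlayer hm hx ▸ hlayer hn hy ▸ hq')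
        (fun σ σ' hσ => hamiltonian_congr fun A h1 => hcongr A σ σ' fun q C hA n hn => by
          subst hA
          obtain ⟨m, hm, hm1⟩ := Finset.not_disjoint_iff.1 h1
          obtain ⟨q', hq', y, hy⟩ := hmem hm1
          refine hσ n fun hn2 => hr ?_
          obtain ⟨x, _, hx⟩ := Finset.mem_image.1 hn2
          exact hlayer hn hx ▸ hlayer hm hy ▸ hq') η
      rw [Finset.biUnion_insert, funext hunion,
        ← Measure.bind_bind (measurable_specification hm _).aemeasurable
          (measurable_specification hm _).aemeasurable,
        layerProduct_bind_image_site h𝒜 hJ hU hinj hprimes hμ, ih]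
  intro Λ
  have hΛ : Λ = (Λ.image fun n => ((siteEquiv hp hinj).symm n).1).biUnion
      fun r => (Λ.preimage (site p r) (site_right_injective hp hinj r).injOn).image (site p r) := by
    ext n
    simp only [Finset.mem_biUnion, Finset.mem_image, Finset.mem_preimage]
    constructor
    · intro hn
      have h : site p ((siteEquiv hp hinj).symm n).1 ((siteEquiv hp hinj).symm n).2 = n :=
        (siteEquiv hp hinj).apply_symm_apply n
      exact ⟨_, ⟨n, hn, rfl⟩, _, h.symm ▸ hn, h⟩
    · rintro ⟨r, _, x, hx, rfl⟩
      exact hx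
  rw [hΛ]
  exact hall _ _

/-- Conditioning a Gibbs measure on an event off a layer leaves a Gibbs measure in the layer; the
uniqueness there makes the layer independent of the event. -/
theorem IsGibbs.measure_inter_layer (h𝒜 : ∀ A ∈ 𝒜, A.Nonempty) (hJ : Consistent 𝒜 J)
    (hU : AbsolutelySummable (multPotential 𝒜 J))
    (hinj : Function.Injective p) (hprimes : Set.range p = basePrimes 𝒜)
    {μ : Measure (Config (LayerSite d))} (hμ : IsUniqueGibbs (layerPotential p 𝒜 J) μ)
    {ν : Measure (Config ℕ+)} (hν : IsGibbs (multPotential 𝒜 J) ν) (r : layerIndices p)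
    {B : Set (Config ℕ+)} (hB : MeasurableSet B)
    (hBr : ∀ σ σ' : Config ℕ+, (∀ n, n ∉ Set.range (site p r) → σ n = σ' n) → σ ∈ B → σ' ∈ B)
    {E : Set (Config (LayerSite d))} (hE : MeasurableSet E) :
    ν (B ∩ layer p r ⁻¹' E) = ν B * μ E := by
  have := hν.isProbabilityMeasure
  by_cases h0 : ν B = 0
  · rw [h0, zero_mul]
    exact measure_mono_null Set.inter_subset_left h0
  have hfin : ν B ≠ ⊤ := measure_ne_top ν B
  have hmap : ∀ F : Set (Config (LayerSite d)), MeasurableSet F →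
      (ν.restrict B).map (layer p r) F = ν (B ∩ layer p r ⁻¹' F) := by
    intro F hF
    rw [Measure.map_apply (measurable_layer r) hF, Measure.restrict_apply (measurable_layer r hF),
      Set.inter_comm]
  have hG : IsGibbs (layerPotential p 𝒜 J)
      ((ν B)⁻¹ • (ν.restrict B).map (layer p r)) := by
    refine ⟨⟨?_⟩, fun Λ F hF => ?_⟩
    · rw [Measure.smul_apply, hmap _ MeasurableSet.univ, Set.preimage_univ, Set.inter_univ,
        smul_eq_mul, ENNReal.inv_mul_cancel h0 hfin]
    · rw [lintegral_smul_measure, Measure.smul_apply, hmap F hF,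
        ← bind_specification_image_site h𝒜 hJ hU hinj hprimes r Λ ν hB hBr hF,
        (isGibbs_iff_bind (measurable_hamiltonian_multPotential hU)).1 hν]
  rw [← hμ.2 _ hG, Measure.smul_apply, hmap E hE, smul_eq_mul, ← mul_assoc,
    ENNReal.mul_inv_cancel h0 hfin, one_mul]

/-- Uniqueness passes from a layer to `ℕ`; the Gibbs measure is the product over the layers. -/
theorem layerProduct_isUniqueGibbs (h𝒜 : ∀ A ∈ 𝒜, A.Nonempty) (hJ : Consistent 𝒜 J)
    (hU : AbsolutelySummable (multPotential 𝒜 J))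
    (hinj : Function.Injective p) (hprimes : Set.range p = basePrimes 𝒜)
    {μ : Measure (Config (LayerSite d))} [IsProbabilityMeasure μ]
    (hμ : IsUniqueGibbs (layerPotential p 𝒜 J) μ) :
    IsUniqueGibbs (multPotential 𝒜 J)
      (layerProduct (prime_of_range_eq_basePrimes hprimes) hinj μ) := by
  classical
  have hp := prime_of_range_eq_basePrimes hprimes
  refine ⟨layerProduct_isGibbs h𝒜 hJ hU hinj hprimes hμ.1, fun ν hν => ?_⟩
  have := hν.isProbabilityMeasure
  refine eq_layerProduct hp hinj μ fun s t ht => ?_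
  induction s using Finset.induction_on with
  | empty =>
    have h : layerCylinder p ∅ t = Set.univ := by
      ext σ
      simp [layerCylinder]
    rw [h, measure_univ, Finset.prod_empty]
  | insert r s hr ih =>
    rw [layerCylinder_insert, hν.measure_inter_layer h𝒜 hJ hU hinj hprimes hμ r
      (measurableSet_layerCylinder s ht) (mem_layerCylinder_congr hp hinj hr) (ht r), ih,
      Finset.prod_insert hr, mul_comm]

end Gibbs

/-! ### Logarithmic moment generating functions of bounded random variables -/

section BoundedCgf

open ProbabilityTheory

variable {Ω : Type} [MeasurableSpace Ω] {μ : Measure Ω} [IsProbabilityMeasure μ] {X : Ω → ℝ}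
  {C : ℝ}

theorem integrable_exp_mul_of_abs_le_const (hX : Measurable X) (hC : ∀ ω, |X ω| ≤ C) (t : ℝ) :
    Integrable (fun ω => Real.exp (t * X ω)) μ := by
  refine Integrable.of_bound (C := Real.exp (|t| * C))
    (Real.measurable_exp.comp (hX.const_mul t)).aestronglyMeasurable (ae_of_all _ fun ω => ?_)
  rw [Real.norm_eq_abs, abs_of_pos (Real.exp_pos _), Real.exp_le_exp]
  calc t * X ω ≤ |t * X ω| := le_abs_self _
    _ = |t| * |X ω| := abs_mul _ _
    _ ≤ |t| * C := mul_le_mul_of_nonneg_left (hC ω) (abs_nonneg t)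

theorem integrable_exp_of_abs_le_const (hX : Measurable X) (hC : ∀ ω, |X ω| ≤ C) :
    Integrable (fun ω => Real.exp (X ω)) μ := by
  simpa using integrable_exp_mul_of_abs_le_const (μ := μ) hX hC 1

theorem abs_log_integral_exp_le (hX : Measurable X) (hC : ∀ ω, |X ω| ≤ C) :
    |Real.log (∫ ω, Real.exp (X ω) ∂μ)| ≤ C := by
  have hint := integrable_exp_of_abs_le_const (μ := μ) hX hC
  have hpos : 0 < ∫ ω, Real.exp (X ω) ∂μ := integral_exp_pos hint
  rw [abs_le]
  constructor
  · rw [Real.le_log_iff_exp_le hpos]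
    calc Real.exp (-C) = ∫ _, Real.exp (-C) ∂μ := by simp
      _ ≤ _ := integral_mono (integrable_const _) hint fun ω =>
        Real.exp_le_exp.2 (abs_le.1 (hC ω)).1
  · rw [Real.log_le_iff_le_exp hpos]
    calc _ ≤ ∫ _, Real.exp C ∂μ := integral_mono hint (integrable_const _) fun ω =>
          Real.exp_le_exp.2 (abs_le.1 (hC ω)).2
      _ = Real.exp C := by simp

theorem mem_interior_integrableExpSet_of_abs_le (hX : Measurable X) (hC : ∀ ω, |X ω| ≤ C)
    (t : ℝ) : t ∈ interior (integrableExpSet X μ) := by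
  have h : integrableExpSet X μ = Set.univ :=
    Set.eq_univ_of_forall fun t => integrable_exp_mul_of_abs_le_const hX hC t
  rw [h, interior_univ]
  trivial

theorem hasDerivAt_cgf_of_abs_le (hX : Measurable X) (hC : ∀ ω, |X ω| ≤ C) (t : ℝ) :
    HasDerivAt (cgf X μ) (deriv (cgf X μ) t) t := by
  have h : AnalyticAt ℝ (cgf X μ) t :=
    analyticAt_cgf (mem_interior_integrableExpSet_of_abs_le hX hC t)
  exact h.differentiableAt.hasDerivAt

theorem abs_deriv_cgf_le (hX : Measurable X) (hC : ∀ ω, |X ω| ≤ C) (t : ℝ) :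
    |deriv (cgf X μ) t| ≤ C := by
  have hint := integrable_exp_mul_of_abs_le_const (μ := μ) hX hC t
  have hpos : 0 < mgf X μ t := mgf_pos hint
  rw [deriv_cgf (mem_interior_integrableExpSet_of_abs_le hX hC t), abs_div, abs_of_pos hpos,
    div_le_iff₀ hpos, mgf, ← integral_const_mul]
  refine abs_integral_le_integral_abs.trans ?_
  refine integral_mono_of_nonneg (ae_of_all _ fun ω => abs_nonneg _) (hint.const_mul C)
    (ae_of_all _ fun ω => ?_)
  simp only [abs_mul, abs_of_pos (Real.exp_pos _)]
  exact mul_le_mul_of_nonneg_right (hC ω) (Real.exp_pos _).le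

end BoundedCgf

/-! ### Layer pressures and the factorization of the partition sum -/

section LayerPressure

variable {d : ℕ} {p : Fin d → ℕ} {fstar : Config (LayerSite d) → ℝ} {M : ℝ}

theorem continuous_layerShift (x : LayerSite d) : Continuous (layerShift x) :=
  continuous_pi fun _ => continuous_apply _

theorem exists_abs_le_of_continuous {S : Type} {g : Config S → ℝ} (hg : Continuous g) :
    ∃ M, ∀ τ, |g τ| ≤ M := by
  obtain ⟨M, hM⟩ := (isCompact_range hg.abs).bddAbove
  exact ⟨M, fun τ => hM ⟨τ, rfl⟩⟩

theorem measurable_sum_layerShift (hf : Continuous fstar) (Λ : Finset (LayerSite d)) :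
    Measurable fun τ => ∑ x ∈ Λ, fstar (layerShift x τ) :=
  (continuous_finsetSum _ fun x _ => hf.comp (continuous_layerShift x)).measurable

theorem abs_sum_layerShift_le (hM : ∀ τ, |fstar τ| ≤ M) (Λ : Finset (LayerSite d))
    (τ : Config (LayerSite d)) : |∑ x ∈ Λ, fstar (layerShift x τ)| ≤ Λ.card * M := by
  calc _ ≤ ∑ x ∈ Λ, |fstar (layerShift x τ)| := Finset.abs_sum_le_sum_abs _ _
    _ ≤ ∑ x ∈ Λ, M := Finset.sum_le_sum fun x _ => hM _
    _ = _ := by rw [Finset.sum_const, nsmul_eq_mul]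

theorem layerPressure_const_mul (ν : Measure (Config (LayerSite d))) (t : ℝ)
    (Λ : Finset (LayerSite d)) :
    layerPressure ν (fun τ => t * fstar τ) Λ =
      ProbabilityTheory.cgf (fun τ => ∑ x ∈ Λ, fstar (layerShift x τ)) ν t := by
  simp only [layerPressure, ProbabilityTheory.cgf, ProbabilityTheory.mgf, Finset.mul_sum]

variable (ν : Measure (Config (LayerSite d))) [IsProbabilityMeasure ν]

theorem abs_Psi_le (hf : Continuous fstar) (hM : ∀ τ, |fstar τ| ≤ M) (l : ℕ) :
    |Psi p ν fstar l| ≤ l * M := by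
  have hM0 : 0 ≤ M := (abs_nonneg _).trans (hM fun _ => 1)
  unfold Psi
  split_ifs with h
  · have hcard : (l : ℝ) = (layerBox p h.choose.1 h.choose.2).card := by
      exact_mod_cast h.choose_spec.2.symm
    rw [hcard]
    exact abs_log_integral_exp_le (measurable_sum_layerShift hf _) (abs_sum_layerShift_le hM _)
  · rw [abs_zero]
    positivity

theorem exists_hasDerivAt_Psi (hf : Continuous fstar) (hM : ∀ τ, |fstar τ| ≤ M) (l : ℕ) :
    ∃ D : ℝ → ℝ, ∀ t,
      HasDerivAt (fun t => Psi p ν (fun τ => t * fstar τ) l) (D t) t ∧ |D t| ≤ l * M := by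
  have hM0 : 0 ≤ M := (abs_nonneg _).trans (hM fun _ => 1)
  unfold Psi
  split_ifs with h
  · have hX := measurable_sum_layerShift hf (layerBox p h.choose.1 h.choose.2)
    have hC := abs_sum_layerShift_le hM (layerBox p h.choose.1 h.choose.2)
    refine ⟨deriv (ProbabilityTheory.cgf (fun τ =>
      ∑ x ∈ layerBox p h.choose.1 h.choose.2, fstar (layerShift x τ)) ν), fun t => ⟨?_, ?_⟩⟩
    · simp only [layerPressure_const_mul]
      exact hasDerivAt_cgf_of_abs_le hX hC t
    · have hcard : (l : ℝ) = (layerBox p h.choose.1 h.choose.2).card := by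
        exact_mod_cast h.choose_spec.2.symm
      rw [hcard]
      exact abs_deriv_cgf_le hX hC t
  · refine ⟨fun _ => 0, fun t => ⟨hasDerivAt_const _ _, ?_⟩⟩
    rw [abs_zero]
    positivity

end LayerPressure

section Factorization

open ProbabilityTheory

variable {d : ℕ} {p : Fin d → ℕ} {f : Config ℕ+ → ℝ} {fstar : Config (LayerSite d) → ℝ}

/-- The indices of the layers that meet `{1, …, N}`. -/
def layerIndicesUpTo (p : Fin d → ℕ) (N : ℕ) : Finset ℕ :=
  open Classical in (Finset.Icc 1 N).filter fun r => r ∈ layerIndices p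

theorem mem_layerIndicesUpTo {N r : ℕ} :
    r ∈ layerIndicesUpTo p N ↔ r ≤ N ∧ r ∈ layerIndices p := by
  simp only [layerIndicesUpTo, Finset.mem_filter, Finset.mem_Icc]
  exact ⟨fun h => ⟨h.1.2, h.2⟩, fun h => ⟨⟨h.2.1, h.1⟩, h.2⟩⟩

/-- The same indices, as elements of the type of all layer indices. -/
def boundedLayers (p : Fin d → ℕ) (N : ℕ) : Finset (layerIndices p) :=
  open Classical in (layerIndicesUpTo p N).subtype (· ∈ layerIndices p)

theorem mem_boundedLayers {N : ℕ} {r : layerIndices p} :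
    r ∈ boundedLayers p N ↔ (r : ℕ) ≤ N := by
  simp only [boundedLayers, Finset.mem_subtype, mem_layerIndicesUpTo]
  exact ⟨fun h => h.1, fun h => ⟨h, r.2⟩⟩

theorem firstLayer_multShift (hp : ∀ i, (p i).Prime) (r : layerIndices p) (x : LayerSite d)
    (σ : Config ℕ+) :
    firstLayer p (multShift (site p r x) σ) = layerShift x (layer p r σ) := by
  funext y
  simp only [firstLayer, multShift, layerShift, layer]
  congr 1
  refine PNat.eq ?_
  rw [PNat.mul_coe, site_add hp, PNat.toPNat'_coe (primePower_pos hp y)]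

/-- The sum of the `T_i f` splits into one sum for each layer. -/
theorem multSum_eq_sum_layers (hp : ∀ i, (p i).Prime) (hinj : Function.Injective p)
    (hf : IsFirstLayer p f fstar) (N : ℕ) (σ : Config ℕ+) :
    multSum f N σ = ∑ r ∈ boundedLayers p N, ∑ x ∈ layerBox p r N,
      fstar (layerShift x (layer p r σ)) := by
  rw [Finset.sum_sigma']
  symm
  refine Finset.sum_bij (fun a _ => (site p a.1 a.2).natPred) ?_ ?_ ?_ ?_
  · rintro ⟨r, x⟩ ha
    simp only [Finset.mem_sigma] at ha
    have h := (mem_layerBox (two_le_of_prime hp) r.2.1 N x).1 ha.2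
    rw [← coe_site hp, ← PNat.natPred_add_one] at h
    exact Finset.mem_range.2 h
  · rintro ⟨r, x⟩ _ ⟨s, y⟩ _ h
    have := @site_injective d p hp hinj (r, x) (s, y) (PNat.natPred_injective h)
    obtain ⟨rfl, rfl⟩ := Prod.mk.inj this
    rfl
  · intro i hi
    obtain ⟨⟨r, x⟩, hrx⟩ := site_surjective hp hinj i.succPNat
    dsimp only at hrx
    have hle : (r : ℕ) * primePower p x ≤ N := by
      rw [← coe_site hp, hrx, Nat.succPNat_coe]
      exact Finset.mem_range.1 hi
    refine ⟨⟨r, x⟩, Finset.mem_sigma.2 ⟨mem_boundedLayers.2 ?_, ?_⟩, ?_⟩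
    · exact (Nat.le_mul_of_pos_right _ (primePower_pos hp x)).trans hle
    · exact (mem_layerBox (two_le_of_prime hp) r.2.1 N x).2 hle
    · dsimp only
      rw [hrx, Nat.natPred_succPNat]
  · rintro ⟨r, x⟩ _
    dsimp only
    rw [PNat.succPNat_natPred, hf.2, firstLayer_multShift hp]

/-- Independence of the layers turns the logarithmic moment generating function of the whole sum
into the sum of the layer pressures. -/
theorem finitePressure_layerProduct (hp : ∀ i, (p i).Prime) (hinj : Function.Injective p)
    (μ : Measure (Config (LayerSite d))) [IsProbabilityMeasure μ]
    (hf : IsFirstLayer p f fstar) (N : ℕ) :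
    finitePressure (layerProduct hp hinj μ) f N =
      1 / (N : ℝ) * ∑ r ∈ layerIndicesUpTo p N, Psi p μ fstar (layerBox p r N).card := by
  let g : layerIndices p → Config (LayerSite d) → ℝ := fun r τ =>
    Real.exp (∑ x ∈ layerBox p r N, fstar (layerShift x τ))
  have hg : ∀ r, Measurable (g r) := fun r =>
    Real.measurable_exp.comp (measurable_sum_layerShift hf.1 _)
  have hgpos : ∀ r, 0 < ∫ τ, g r τ ∂μ := fun r => by
    obtain ⟨M, hM⟩ := exists_abs_le_of_continuous hf.1
    exact integral_exp_pos (integrable_exp_of_abs_le_const (measurable_sum_layerShift hf.1 _)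
      (abs_sum_layerShift_le hM _))
  have hexp : ∀ σ, Real.exp (multSum f N σ) =
      ∏ r ∈ boundedLayers p N, g r (layersEquiv hp hinj σ r) := fun σ => by
    rw [multSum_eq_sum_layers hp hinj hf, Real.exp_sum]
    rfl
  have hint : ∫ σ, Real.exp (multSum f N σ) ∂layerProduct hp hinj μ =
      ∏ r ∈ boundedLayers p N, ∫ τ, g r τ ∂μ := by
    simp only [hexp]
    rw [← (layersEquiv hp hinj).measurableEmbedding.integral_map
      (fun τ : layerIndices p → Config (LayerSite d) => ∏ r ∈ boundedLayers p N, g r (τ r)),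
      map_layersEquiv_layerProduct]
    have hind := (iIndepFun_infinitePi (P := fun _ : layerIndices p => μ) hg).precomp
      (g := fun r : boundedLayers p N => (r : layerIndices p)) Subtype.val_injective
    have h := hind.integral_fun_prod_eq_prod_integral fun r =>
      ((hg r).comp (measurable_pi_apply (r : layerIndices p))).aestronglyMeasurable
    have hcoe : ∀ τ : layerIndices p → Config (LayerSite d),
        ∏ r ∈ boundedLayers p N, g r (τ r) = ∏ r : boundedLayers p N, g r (τ r) := fun τ =>
      (Finset.prod_coe_sort _ fun r => g r (τ r)).symm
    simp only [hcoe]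
    refine h.trans ?_
    rw [← Finset.prod_coe_sort (boundedLayers p N) fun r => ∫ τ, g r τ ∂μ]
    refine Finset.prod_congr rfl fun r _ => ?_
    have hmap := Measure.infinitePi_map_eval (fun _ : layerIndices p => μ) r
    conv_rhs => rw [← hmap]
    rw [integral_map (measurable_pi_apply (r : layerIndices p)).aemeasurable
      (hg r).aestronglyMeasurable]
  have hPsi : ∀ r : layerIndices p,
      Real.log (∫ τ, g r τ ∂μ) = Psi p μ fstar (layerBox p r N).card := fun r =>
    (Psi_card_layerBox (two_le_of_prime hp) μ fstar r.2 N).symm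
  rw [finitePressure, hint, Real.log_prod fun r _ => (hgpos r).ne']
  congr 1
  simp only [hPsi]
  classical
  have hR : layerIndicesUpTo p N =
      (boundedLayers p N).map (Function.Embedding.subtype (· ∈ layerIndices p)) := by
    ext r
    simp only [Finset.mem_map, mem_boundedLayers, mem_layerIndicesUpTo,
      Function.Embedding.coe_subtype]
    exact ⟨fun h => ⟨⟨r, h.2⟩, h.1, rfl⟩, by rintro ⟨r, h, rfl⟩; exact ⟨h, r.2⟩⟩
  rw [hR, Finset.sum_map]
  rfl

end Factorization

/-! ### The density of the layer indices -/

section Density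

variable {d : ℕ} {p : Fin d → ℕ}

theorem kappa_eq_prod (p : Fin d → ℕ) : kappa p = ∏ i, (1 - 1 / (p i : ℝ)) := by
  have h : ∀ i, 1 - 1 / (p i : ℝ) = 1 + -(1 / (p i : ℝ)) := fun i => sub_eq_add_neg _ _
  simp only [h, Finset.prod_one_add, kappa, Finset.powerset_univ]
  refine Finset.sum_congr rfl fun T _ => ?_
  rw [Finset.prod_neg, Finset.prod_div_distrib, Finset.prod_const_one, mul_one_div]

theorem kappa_pos (hp : ∀ i, (p i).Prime) : 0 < kappa p := by
  rw [kappa_eq_prod]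
  refine Finset.prod_pos fun i _ => ?_
  have h : (1 : ℝ) < p i := by exact_mod_cast (hp i).one_lt
  rw [sub_pos, div_lt_one (by linarith)]
  exact h

theorem totient_prod_primes (hp : ∀ i, (p i).Prime) (hinj : Function.Injective p) :
    (Nat.totient (∏ i, p i) : ℝ) = kappa p * (∏ i, p i : ℕ) := by
  have h1 : ∏ i, p i = ∏ q ∈ Finset.univ.image p, q :=
    (Finset.prod_image (f := fun q => q) fun a _ b _ h => hinj h).symm
  have hpf : (∏ i, p i).primeFactors = Finset.univ.image p := by
    rw [h1, Nat.primeFactors_prod]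
    intro q hq
    obtain ⟨i, _, rfl⟩ := Finset.mem_image.1 hq
    exact hp i
  have h2 := Nat.totient_eq_mul_prod_factors (∏ i, p i)
  rw [hpf, Finset.prod_image fun a _ b _ h => hinj h] at h2
  have h3 : (Nat.totient (∏ i, p i) : ℝ) =
      ((∏ i, p i : ℕ) : ℝ) * ∏ i, (1 - (p i : ℝ)⁻¹) := by
    have h4 := congrArg (fun q : ℚ => (q : ℝ)) h2
    push_cast at h4 ⊢
    exact h4
  rw [h3, kappa_eq_prod, mul_comm]
  simp only [one_div]

theorem mem_layerIndices_iff_coprime (hp : ∀ i, (p i).Prime) {r : ℕ} :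
    r ∈ layerIndices p ↔ 1 ≤ r ∧ (∏ i, p i).Coprime r := by
  rw [Nat.coprime_prod_left_iff]
  refine and_congr_right fun _ => ?_
  simp only [Finset.mem_univ, true_implies]
  exact forall_congr' fun i => ((hp i).coprime_iff_not_dvd).symm

/-- The layer indices have density `κ`, with a bounded error in the counting function: the set is
periodic modulo `∏ p_i`. -/
theorem exists_abs_card_layerIndicesUpTo_sub_le (hp : ∀ i, (p i).Prime)
    (hinj : Function.Injective p) :
    ∃ C : ℝ, ∀ n : ℕ, |((layerIndicesUpTo p n).card : ℝ) - kappa p * n| ≤ C := by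
  set P := ∏ i, p i with hP
  have hP0 : 0 < P := Finset.prod_pos fun i _ => (hp i).pos
  have hset : ∀ n, layerIndicesUpTo p n = (Finset.Ico 1 (n + 1)).filter P.Coprime := by
    intro n
    ext r
    rw [mem_layerIndicesUpTo, mem_layerIndices_iff_coprime hp, Finset.mem_filter, Finset.mem_Ico]
    constructor
    · rintro ⟨h1, h2, h3⟩
      exact ⟨⟨h2, by omega⟩, h3⟩
    · rintro ⟨⟨h1, h2⟩, h3⟩
      exact ⟨by omega, h1, h3⟩
  have hstep : ∀ n, (layerIndicesUpTo p (n + P)).card =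
      (layerIndicesUpTo p n).card + P.totient := by
    intro n
    rw [hset, hset, ← Nat.filter_coprime_Ico_eq_totient P (n + 1),
      ← Finset.card_union_of_disjoint, ← Finset.filter_union]
    · congr 2
      rw [Finset.Ico_union_Ico_eq_Ico (by omega) (by omega)]
      congr 1
      omega
    · exact Finset.disjoint_filter_filter (Finset.Ico_disjoint_Ico_consecutive 1 (n + 1) _)
  let g : ℕ → ℝ := fun n => ((layerIndicesUpTo p n).card : ℝ) - kappa p * n
  have hper : Function.Periodic g P := fun n => by
    simp only [g, hstep]
    push_cast
    rw [totient_prod_primes hp hinj, ← hP]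
    ring
  refine ⟨∑ m ∈ Finset.range P, |g m|, fun n => ?_⟩
  change |g n| ≤ _
  rw [← hper.map_mod_nat n]
  exact Finset.single_le_sum (f := fun m => |g m|) (fun m _ => abs_nonneg _)
    (Finset.mem_range.2 (Nat.mod_lt n hP0))

end Density

/-! ### Counting lattice points in simplices -/

section Simplex

variable {d : ℕ} {p : Fin d → ℕ}

theorem latticeSimplex_mono {ρ ρ' : ℝ} (h : ρ ≤ ρ') :
    latticeSimplex p ρ ⊆ latticeSimplex p ρ' := fun _ hx => le_trans hx h

theorem latticeSimplex_subset (hp : ∀ i, 2 ≤ p i) (ρ : ℝ) :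
    latticeSimplex p ρ ⊆
      ((Fintype.piFinset fun _ : Fin d => Finset.range (⌊2 * ρ⌋₊ + 1) : Finset (LayerSite d)) :
        Set (LayerSite d)) := by
  intro x hx
  have hx' : ∑ i, (x i : ℝ) * Real.log (p i) ≤ ρ := hx
  rw [Finset.mem_coe, Fintype.mem_piFinset]
  intro i
  have hlog : ∀ j, 1 / 2 ≤ Real.log (p j) := fun j => by
    have h1 : Real.log 2 ≤ Real.log (p j) :=
      Real.log_le_log (by norm_num) (by exact_mod_cast hp j)
    linarith [Real.log_two_gt_d9]
  have h1 : (x i : ℝ) * Real.log (p i) ≤ ∑ j, (x j : ℝ) * Real.log (p j) :=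
    Finset.single_le_sum (f := fun j => (x j : ℝ) * Real.log (p j))
      (fun j _ => mul_nonneg (Nat.cast_nonneg _) (by linarith [hlog j])) (Finset.mem_univ i)
  have h2 : (x i : ℝ) * (1 / 2) ≤ (x i : ℝ) * Real.log (p i) :=
    mul_le_mul_of_nonneg_left (hlog i) (Nat.cast_nonneg _)
  rw [Finset.mem_range, Nat.lt_succ_iff]
  exact Nat.le_floor (by linarith)

theorem finite_latticeSimplex (hp : ∀ i, 2 ≤ p i) (ρ : ℝ) : (latticeSimplex p ρ).Finite :=
  (Finset.finite_toSet _).subset (latticeSimplex_subset hp ρ)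

theorem ncard_latticeSimplex_mono (hp : ∀ i, 2 ≤ p i) :
    Monotone fun ρ => (latticeSimplex p ρ).ncard := fun _ ρ' h =>
  Set.ncard_le_ncard (latticeSimplex_mono h) (finite_latticeSimplex hp ρ')

/-- The number of lattice points grows polynomially in `ρ`; all that matters below is that its cube
is dominated by `e^ρ`. -/
theorem exists_ncard_latticeSimplex_le (hp : ∀ i, 2 ≤ p i) :
    ∃ C : ℝ, 0 ≤ C ∧ ∀ ρ, 0 ≤ ρ → ((latticeSimplex p ρ).ncard : ℝ) ^ 3 ≤ C * Real.exp ρ := by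
  refine ⟨(6 ^ d * d.factorial * Real.exp 1) ^ 3, by positivity, fun ρ hρ => ?_⟩
  have h1 : (latticeSimplex p ρ).ncard ≤ (⌊2 * ρ⌋₊ + 1) ^ d := by
    refine (Set.ncard_le_ncard (latticeSimplex_subset hp ρ) (Finset.finite_toSet _)).trans ?_
    rw [Set.ncard_coe_finset, Fintype.card_piFinset]
    simp
  have h2 : ((latticeSimplex p ρ).ncard : ℝ) ≤ (6 * (ρ / 3 + 1)) ^ d := by
    have h3 : ((latticeSimplex p ρ).ncard : ℝ) ≤ ((⌊2 * ρ⌋₊ : ℝ) + 1) ^ d := by exact_mod_cast h1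
    refine h3.trans (pow_le_pow_left₀ (by positivity) ?_ d)
    linarith [Nat.floor_le (show 0 ≤ 2 * ρ by linarith)]
  have h4 : (ρ / 3 + 1) ^ d ≤ d.factorial * Real.exp (ρ / 3 + 1) := by
    have := Real.pow_div_factorial_le_exp (ρ / 3 + 1) (by positivity) d
    rwa [div_le_iff₀ (by positivity), mul_comm] at this
  have h5 : ((latticeSimplex p ρ).ncard : ℝ) ≤
      6 ^ d * d.factorial * Real.exp 1 * Real.exp (ρ / 3) := by
    calc _ ≤ _ := h2
      _ = 6 ^ d * (ρ / 3 + 1) ^ d := mul_pow _ _ _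
      _ ≤ 6 ^ d * (d.factorial * Real.exp (ρ / 3 + 1)) := by gcongr
      _ = _ := by rw [Real.exp_add]; ring
  calc ((latticeSimplex p ρ).ncard : ℝ) ^ 3
      ≤ (6 ^ d * d.factorial * Real.exp 1 * Real.exp (ρ / 3)) ^ 3 :=
        pow_le_pow_left₀ (Nat.cast_nonneg _) h5 3
    _ = _ := by rw [mul_pow _ (Real.exp (ρ / 3)), ← Real.exp_nat_mul]; congr 2; push_cast; ring

/-- The set `{ρ ≥ 0 : |D(ρ)| = ℓ}`. -/
def simplexLevel (p : Fin d → ℕ) (l : ℕ) : Set ℝ :=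
  {ρ : ℝ | 0 ≤ ρ ∧ (latticeSimplex p ρ).ncard = l}

theorem bddBelow_simplexLevel (l : ℕ) : BddBelow (simplexLevel p l) := ⟨0, fun _ h => h.1⟩

theorem bddAbove_simplexLevel (hp : ∀ i, 2 ≤ p i) (hd : 1 ≤ d) (l : ℕ) :
    BddAbove (simplexLevel p l) := by
  let i₀ : Fin d := ⟨0, hd⟩
  refine ⟨l * Real.log (p i₀), fun ρ hρ => ?_⟩
  by_contra! hlt
  -- the points of the first axis up to `l` already make `l + 1` points of `D(ρ)`
  have hsub : (((Finset.range (l + 1)).image fun k => (Pi.single i₀ k : LayerSite d) :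
      Finset (LayerSite d)) : Set (LayerSite d)) ⊆ latticeSimplex p ρ := by
    intro x hx
    obtain ⟨k, hk, rfl⟩ := Finset.mem_image.1 (Finset.mem_coe.1 hx)
    have hkl : (k : ℝ) ≤ l := by exact_mod_cast Nat.lt_succ_iff.1 (Finset.mem_range.1 hk)
    have hlog : 0 ≤ Real.log (p i₀) := Real.log_natCast_nonneg _
    change ∑ i, ((Pi.single i₀ k : LayerSite d) i : ℝ) * Real.log (p i) ≤ ρ
    rw [Finset.sum_eq_single i₀]
    · rw [Pi.single_eq_same]
      exact (mul_le_mul_of_nonneg_right hkl hlog).trans hlt.le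
    · intro j _ hj
      rw [Pi.single_eq_of_ne hj]
      simp
    · simp
  have hcard := Set.ncard_le_ncard hsub (finite_latticeSimplex hp ρ)
  rw [Set.ncard_coe_finset, Finset.card_image_of_injective _ (Pi.single_injective i₀),
    Finset.card_range, hρ.2] at hcard
  omega

theorem mem_simplexLevel_of_lt_of_lt (hp : ∀ i, 2 ≤ p i) {l : ℕ}
    (hne : (simplexLevel p l).Nonempty) {ρ : ℝ} (h1 : rhoMinus p l < ρ) (h2 : ρ < rhoPlus p l) :
    ρ ∈ simplexLevel p l := by
  obtain ⟨a, ha, haρ⟩ := exists_lt_of_csInf_lt hne h1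
  obtain ⟨b, hb, hρb⟩ := exists_lt_of_lt_csSup hne h2
  refine ⟨ha.1.trans haρ.le, le_antisymm ?_ ?_⟩
  · exact (ncard_latticeSimplex_mono hp hρb.le).trans hb.2.le
  · exact ha.2.ge.trans (ncard_latticeSimplex_mono hp haρ.le)

/-- `Λ^r_N = D(log (N / r))`. -/
theorem latticeSimplex_log_div (hp : ∀ i, (p i).Prime) {r N : ℕ} (hr : 1 ≤ r) (hN : 1 ≤ N) :
    latticeSimplex p (Real.log (N / r)) = (layerBox p r N : Set (LayerSite d)) := by
  ext x
  rw [Finset.mem_coe, mem_layerBox (two_le_of_prime hp) hr]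
  have hr' : (0 : ℝ) < r := by exact_mod_cast hr
  have hN' : (0 : ℝ) < N := by exact_mod_cast hN
  have hpp : (0 : ℝ) < primePower p x := by exact_mod_cast primePower_pos hp x
  have hlog : ∑ i, (x i : ℝ) * Real.log (p i) = Real.log (primePower p x) := by
    unfold primePower
    push_cast
    rw [Real.log_prod fun i _ => pow_ne_zero _ (by exact_mod_cast (hp i).ne_zero)]
    simp only [Real.log_pow]
  change ∑ i, (x i : ℝ) * Real.log (p i) ≤ Real.log (N / r) ↔ _
  rw [hlog, Real.log_le_log_iff hpp (div_pos hN' hr'), le_div_iff₀ hr', mul_comm]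
  exact_mod_cast Iff.rfl

theorem log_div_mem_simplexLevel_iff (hp : ∀ i, (p i).Prime) {r N l : ℕ} (hr : 1 ≤ r)
    (hrN : r ≤ N) :
    Real.log (N / r) ∈ simplexLevel p l ↔ (layerBox p r N).card = l := by
  have hr' : (0 : ℝ) < r := by exact_mod_cast hr
  have h : 0 ≤ Real.log (N / r) := Real.log_nonneg ((one_le_div hr').2 (by exact_mod_cast hrN))
  rw [← Set.ncard_coe_finset, ← latticeSimplex_log_div hp hr (hr.trans hrN)]
  exact ⟨fun h => h.2, fun h' => ⟨h, h'⟩⟩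

end Simplex

/-! ### The limit of the pressures -/

section Count

variable {d : ℕ} {p : Fin d → ℕ}

/-- The indices `r ≤ N` of the layers for which `|Λ^r_N| = ℓ`. -/
def layersOfCard (p : Fin d → ℕ) (N l : ℕ) : Finset ℕ :=
  (layerIndicesUpTo p N).filter fun r => (layerBox p r N).card = l

theorem mem_layersOfCard (hp : ∀ i, (p i).Prime) {N l r : ℕ} :
    r ∈ layersOfCard p N l ↔
      r ∈ layerIndicesUpTo p N ∧ Real.log (N / r) ∈ simplexLevel p l := by
  rw [layersOfCard, Finset.mem_filter]
  refine and_congr_right fun hr => ?_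
  have h := mem_layerIndicesUpTo.1 hr
  exact (log_div_mem_simplexLevel_iff hp h.2.1 h.1).symm

/-- Layers of size `ℓ` have index at most of order `N / ℓ ^ 3`. -/
theorem card_layersOfCard_le (hp : ∀ i, (p i).Prime) {C : ℝ} (hC0 : 0 ≤ C)
    (hC : ∀ ρ, 0 ≤ ρ → ((latticeSimplex p ρ).ncard : ℝ) ^ 3 ≤ C * Real.exp ρ)
    (N : ℕ) {l : ℕ} (hl : 1 ≤ l) :
    ((layersOfCard p N l).card : ℝ) ≤ C * N / l ^ 3 := by
  have hl' : (0 : ℝ) < (l : ℝ) ^ 3 := by positivity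
  have hsub : layersOfCard p N l ⊆ Finset.Icc 1 ⌊C * N / (l : ℝ) ^ 3⌋₊ := by
    intro r hr
    obtain ⟨hr1, hr2⟩ := (mem_layersOfCard hp).1 hr
    obtain ⟨hrN, hrK⟩ := mem_layerIndicesUpTo.1 hr1
    have hr0 : (0 : ℝ) < r := by exact_mod_cast hrK.1
    have hN0 : (0 : ℝ) < N := hr0.trans_le (by exact_mod_cast hrN)
    have h := hC _ hr2.1
    rw [hr2.2, Real.exp_log (div_pos hN0 hr0), ← mul_div_assoc, le_div_iff₀ hr0] at h
    rw [Finset.mem_Icc]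
    refine ⟨hrK.1, Nat.le_floor ?_⟩
    rw [le_div_iff₀ hl']
    linarith
  calc ((layersOfCard p N l).card : ℝ) ≤ (⌊C * N / (l : ℝ) ^ 3⌋₊ : ℝ) := by
        have := Finset.card_le_card hsub
        rw [Nat.card_Icc, Nat.add_sub_cancel] at this
        exact_mod_cast this
    _ ≤ _ := Nat.floor_le (by positivity)

theorem layerIndicesUpTo_subset {m n : ℕ} (h : m ≤ n) :
    layerIndicesUpTo p m ⊆ layerIndicesUpTo p n := fun r hr => by
  rw [mem_layerIndicesUpTo] at hr ⊢
  exact ⟨hr.1.trans h, hr.2⟩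

/-- Up to a bounded error, the layers of size `ℓ` are those with index between `e^{-ρ^+(ℓ)} N` and
`e^{-ρ^-(ℓ)} N`. -/
theorem exists_abs_card_layersOfCard_sub_le (hp : ∀ i, (p i).Prime) (hinj : Function.Injective p)
    (hd : 1 ≤ d) (l : ℕ) : ∃ C : ℝ, ∀ N : ℕ, 1 ≤ N →
      |((layersOfCard p N l).card : ℝ) -
        kappa p * (Real.exp (-rhoMinus p l) - Real.exp (-rhoPlus p l)) * N| ≤ C := by
  have hp2 := two_le_of_prime hp
  rcases (simplexLevel p l).eq_empty_or_nonempty with he | hne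
  · refine ⟨0, fun N _ => ?_⟩
    have h1 : layersOfCard p N l = ∅ := by
      refine Finset.eq_empty_of_forall_notMem fun r hr => ?_
      have := ((mem_layersOfCard hp).1 hr).2
      rw [he] at this
      exact this
    -- both bounds of an empty level are `0`
    have h2 : rhoMinus p l = 0 := by
      change sInf (simplexLevel p l) = 0
      rw [he, Real.sInf_empty]
    have h3 : rhoPlus p l = 0 := by
      change sSup (simplexLevel p l) = 0
      rw [he, Real.sSup_empty]
    rw [h1, h2, h3]
    simp
  obtain ⟨C, hC⟩ := exists_abs_card_layerIndicesUpTo_sub_le hp hinj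
  have hκ := kappa_pos hp
  refine ⟨2 * C + 2 * kappa p, fun N hN => ?_⟩
  have hN0 : (0 : ℝ) < N := by exact_mod_cast hN
  set a := Real.exp (-rhoPlus p l) with ha
  set b := Real.exp (-rhoMinus p l) with hb
  have hbdd := bddAbove_simplexLevel hp2 hd l
  obtain ⟨ρ₀, hρ₀⟩ := hne
  have hab : a ≤ b := by
    rw [ha, hb, Real.exp_le_exp, neg_le_neg_iff]
    exact (csInf_le (bddBelow_simplexLevel l) hρ₀).trans (le_csSup hbdd hρ₀)
  have hb1 : b ≤ 1 := by
    rw [hb, Real.exp_le_one_iff, neg_nonpos]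
    exact le_csInf ⟨ρ₀, hρ₀⟩ fun ρ h => h.1
  have ha0 : 0 < a := Real.exp_pos _
  have hb0 : 0 < b := Real.exp_pos _
  have haN : 0 < a * N := mul_pos ha0 hN0
  have hbN : 0 < b * N := mul_pos hb0 hN0
  have habN : a * N ≤ b * N := mul_le_mul_of_nonneg_right hab hN0.le
  have hceil : ∀ {y : ℝ}, 0 < y → ((⌈y⌉₊ - 1 : ℕ) : ℝ) = ⌈y⌉₊ - 1 := fun hy => by
    rw [Nat.cast_sub (Nat.ceil_pos.2 hy), Nat.cast_one]
  have hk := fun n => abs_le.1 (hC n)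
  -- multiplication by `κ` of an inequality between counting bounds
  have hmul : ∀ {x y : ℝ}, x ≤ y → kappa p * x ≤ kappa p * y := fun h =>
    mul_le_mul_of_nonneg_left h hκ.le
  have hupper : (layersOfCard p N l).card + (layerIndicesUpTo p (⌈a * N⌉₊ - 1)).card ≤
      (layerIndicesUpTo p ⌊b * N⌋₊).card := by
    rw [← Finset.card_union_of_disjoint]
    · refine Finset.card_le_card (Finset.union_subset (fun r hr => ?_) (layerIndicesUpTo_subset ?_))
      · obtain ⟨hr1, hr2⟩ := (mem_layersOfCard hp).1 hr
        obtain ⟨hrN, hrK⟩ := mem_layerIndicesUpTo.1 hr1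
        have hr0 : (0 : ℝ) < r := by exact_mod_cast hrK.1
        refine mem_layerIndicesUpTo.2 ⟨Nat.le_floor ?_, hrK⟩
        have h : rhoMinus p l ≤ Real.log (N / r) := csInf_le (bddBelow_simplexLevel l) hr2
        have h' := Real.exp_le_exp.2 (neg_le_neg h)
        rw [← Real.log_inv, Real.exp_log (inv_pos.2 (div_pos hN0 hr0)), inv_div,
          div_le_iff₀ hN0] at h'
        exact h'
      · rw [Nat.le_floor_iff hbN.le, hceil haN]
        linarith [Nat.ceil_lt_add_one haN.le]
    · refine Finset.disjoint_left.2 fun r hr hr' => ?_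
      obtain ⟨hr1, hr2⟩ := (mem_layersOfCard hp).1 hr
      obtain ⟨hrN, hrK⟩ := mem_layerIndicesUpTo.1 hr1
      have hr0 : (0 : ℝ) < r := by exact_mod_cast hrK.1
      have h : Real.log (N / r) ≤ rhoPlus p l := le_csSup hbdd hr2
      have h' := Real.exp_le_exp.2 (neg_le_neg h)
      rw [← Real.log_inv, Real.exp_log (inv_pos.2 (div_pos hN0 hr0)), inv_div,
        le_div_iff₀ hN0] at h'
      have h1 := (mem_layerIndicesUpTo.1 hr').1
      have h2 : ⌈a * N⌉₊ ≤ r := Nat.ceil_le.2 h'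
      have h3 := Nat.ceil_pos.2 haN
      omega
  have hlower : (layerIndicesUpTo p (⌈b * N⌉₊ - 1)).card ≤
      (layersOfCard p N l).card + (layerIndicesUpTo p ⌊a * N⌋₊).card := by
    refine (Finset.card_le_card fun r hr => ?_).trans (Finset.card_union_le _ _)
    obtain ⟨hrb, hrK⟩ := mem_layerIndicesUpTo.1 hr
    have hr0 : (0 : ℝ) < r := by exact_mod_cast hrK.1
    rw [Finset.mem_union]
    by_cases hra : r ≤ ⌊a * N⌋₊
    · exact Or.inr (mem_layerIndicesUpTo.2 ⟨hra, hrK⟩)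
    left
    have h1 : a * N < r := (Nat.floor_lt haN.le).1 (not_le.1 hra)
    have h2 : (r : ℝ) < b * N := by
      rw [← Nat.lt_ceil]
      have := Nat.ceil_pos.2 hbN
      omega
    have hrN : (r : ℝ) ≤ N := h2.le.trans (by nlinarith)
    have h3 : Real.log (N / r) = -Real.log (r / N) := by rw [← Real.log_inv, inv_div]
    refine (mem_layersOfCard hp).2 ⟨mem_layerIndicesUpTo.2 ⟨by exact_mod_cast hrN, hrK⟩,
      mem_simplexLevel_of_lt_of_lt hp2 ⟨ρ₀, hρ₀⟩ ?_ ?_⟩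
    · rw [h3, lt_neg, Real.log_lt_iff_lt_exp (div_pos hr0 hN0), div_lt_iff₀ hN0]
      exact h2
    · rw [h3, neg_lt, Real.lt_log_iff_exp_lt (div_pos hr0 hN0), lt_div_iff₀ hN0]
      exact h1
  have hupper' : ((layersOfCard p N l).card : ℝ) +
      (layerIndicesUpTo p (⌈a * N⌉₊ - 1)).card ≤ (layerIndicesUpTo p ⌊b * N⌋₊).card := by
    exact_mod_cast hupper
  have hlower' : ((layerIndicesUpTo p (⌈b * N⌉₊ - 1)).card : ℝ) ≤
      (layersOfCard p N l).card + (layerIndicesUpTo p ⌊a * N⌋₊).card := by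
    exact_mod_cast hlower
  have e1 := hk (⌈a * N⌉₊ - 1)
  have e2 := hk ⌊b * N⌋₊
  have e3 := hk (⌈b * N⌉₊ - 1)
  have e4 := hk ⌊a * N⌋₊
  rw [hceil haN] at e1
  rw [hceil hbN] at e3
  have f1 := hmul (Nat.le_ceil (a * N))
  have f2 := hmul (Nat.floor_le hbN.le)
  have f3 := hmul (Nat.le_ceil (b * N))
  have f4 := hmul (Nat.floor_le haN.le)
  rw [abs_le]
  constructor <;> linarith [e1.1, e1.2, e2.1, e2.2, e3.1, e3.2, e4.1, e4.2]

theorem tendsto_card_layersOfCard_div (hp : ∀ i, (p i).Prime) (hinj : Function.Injective p)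
    (hd : 1 ≤ d) (l : ℕ) :
    Tendsto (fun N : ℕ => ((layersOfCard p N l).card : ℝ) / N) atTop
      (𝓝 (kappa p * (Real.exp (-rhoMinus p l) - Real.exp (-rhoPlus p l)))) := by
  obtain ⟨C, hC⟩ := exists_abs_card_layersOfCard_sub_le hp hinj hd l
  rw [tendsto_iff_norm_sub_tendsto_zero]
  refine squeeze_zero' (Eventually.of_forall fun N => norm_nonneg _) ?_
    (tendsto_const_div_atTop_nhds_zero_nat C)
  filter_upwards [eventually_ge_atTop 1] with N hN
  have hN0 : (0 : ℝ) < N := by exact_mod_cast hN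
  rw [Real.norm_eq_abs, le_div_iff₀ hN0, ← abs_of_pos hN0, ← abs_mul, abs_of_pos hN0, sub_mul,
    div_mul_cancel₀ _ hN0.ne']
  exact hC N hN

theorem sum_comp_card_eq_tsum {s : Finset ℕ} {c : ℕ → ℕ} (hc : ∀ r ∈ s, 1 ≤ c r) (F : ℕ → ℝ) :
    ∑ r ∈ s, F (c r) = ∑' j : ℕ, ((s.filter fun r => c r = j + 1).card : ℝ) * F (j + 1) := by
  rw [tsum_eq_sum (s := s.image fun r => c r - 1)]
  · rw [← Finset.sum_fiberwise_of_maps_to (g := fun r => c r - 1)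
      (fun r hr => Finset.mem_image_of_mem _ hr)]
    refine Finset.sum_congr rfl fun j _ => ?_
    have h : s.filter (fun r => c r - 1 = j) = s.filter fun r => c r = j + 1 :=
      Finset.filter_congr fun r hr => by have := hc r hr; omega
    rw [h, Finset.sum_congr rfl fun r hr => by rw [(Finset.mem_filter.1 hr).2], Finset.sum_const,
      nsmul_eq_mul]
  · intro j hj
    have h : s.filter (fun r => c r = j + 1) = ∅ := by
      refine Finset.filter_eq_empty_iff.2 fun r hr hrj => hj ?_
      exact Finset.mem_image.2 ⟨r, hr, by omega⟩
    rw [h]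
    simp

theorem one_le_card_layerBox (hp : ∀ i, (p i).Prime) {r N : ℕ} (hr : r ∈ layerIndicesUpTo p N) :
    1 ≤ (layerBox p r N).card := by
  obtain ⟨hrN, hrK⟩ := mem_layerIndicesUpTo.1 hr
  refine Finset.card_pos.2 ⟨0, (mem_layerBox (two_le_of_prime hp) hrK.1 N 0).2 ?_⟩
  simpa [primePower] using hrN

theorem finitePressure_eq_tsum (hp : ∀ i, (p i).Prime) (hinj : Function.Injective p)
    (μ : Measure (Config (LayerSite d))) [IsProbabilityMeasure μ] {f : Config ℕ+ → ℝ}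
    {fstar : Config (LayerSite d) → ℝ} (hf : IsFirstLayer p f fstar) (N : ℕ) :
    finitePressure (layerProduct hp hinj μ) f N =
      ∑' j : ℕ, ((layersOfCard p N (j + 1)).card : ℝ) / N * Psi p μ fstar (j + 1) := by
  rw [finitePressure_layerProduct hp hinj μ hf, sum_comp_card_eq_tsum
    (c := fun r => (layerBox p r N).card) (fun r hr => one_le_card_layerBox hp hr),
    ← tsum_mul_left]
  refine tsum_congr fun j => ?_
  rw [layersOfCard]
  ring

/-- A summable majorant of the terms of the series for the pressure. -/
theorem exists_summable_bound (hp : ∀ i, (p i).Prime) : ∃ u : ℕ → ℝ, Summable u ∧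
    ∀ N j : ℕ, ((layersOfCard p N (j + 1)).card : ℝ) / N * (j + 1 : ℕ) ≤ u j := by
  obtain ⟨C, hC0, hC⟩ := exists_ncard_latticeSimplex_le (two_le_of_prime hp)
  refine ⟨fun j => C * (1 / ((j + 1 : ℕ) : ℝ) ^ 2), ?_, fun N j => ?_⟩
  · exact ((summable_nat_add_iff 1).2 (Real.summable_one_div_nat_pow.2 one_lt_two)).mul_left C
  · have h := card_layersOfCard_le hp hC0 hC N (l := j + 1) (by omega)
    have hj : (0 : ℝ) < ((j + 1 : ℕ) : ℝ) := by positivity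
    -- for `N = 0` the quotient on the left is `0`
    rcases Nat.eq_zero_or_pos N with rfl | hN
    · simp only [Nat.cast_zero, div_zero, zero_mul]
      positivity
    have hN0 : (0 : ℝ) < N := by exact_mod_cast hN
    calc ((layersOfCard p N (j + 1)).card : ℝ) / N * (j + 1 : ℕ)
        ≤ C * N / ((j + 1 : ℕ) : ℝ) ^ 3 / N * (j + 1 : ℕ) := by gcongr
      _ = _ := by field_simp

/-- The coefficients of the series, bounded by passing to the limit in `exists_summable_bound`. -/
theorem exists_summable_bound_coeff (hp : ∀ i, (p i).Prime) (hinj : Function.Injective p)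
    (hd : 1 ≤ d) : ∃ u : ℕ → ℝ, Summable u ∧ ∀ j : ℕ,
      |Real.exp (-rhoMinus p (j + 1)) - Real.exp (-rhoPlus p (j + 1))| * (j + 1 : ℕ) ≤ u j := by
  obtain ⟨u, hu, hle⟩ := exists_summable_bound hp
  have hκ := kappa_pos hp
  refine ⟨fun j => (kappa p)⁻¹ * u j, hu.mul_left _, fun j => ?_⟩
  have hlim := tendsto_card_layersOfCard_div hp hinj hd (j + 1)
  have h1 := le_of_tendsto (hlim.mul_const ((j + 1 : ℕ) : ℝ))
    (Eventually.of_forall fun N => hle N j)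
  have h0 := ge_of_tendsto hlim (Eventually.of_forall fun N => by positivity)
  rw [abs_of_nonneg (nonneg_of_mul_nonneg_right h0 hκ), le_inv_mul_iff₀ hκ, ← mul_assoc]
  exact h1

variable (μ : Measure (Config (LayerSite d))) [IsProbabilityMeasure μ]
  {fstar : Config (LayerSite d) → ℝ}

theorem summable_pressure_series (hp : ∀ i, (p i).Prime) (hinj : Function.Injective p)
    (hd : 1 ≤ d) (hf : Continuous fstar) :
    Summable fun j : ℕ => (Real.exp (-rhoMinus p (j + 1)) - Real.exp (-rhoPlus p (j + 1))) *
      Psi p μ fstar (j + 1) := by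
  obtain ⟨M, hM⟩ := exists_abs_le_of_continuous hf
  obtain ⟨u, hu, hle⟩ := exists_summable_bound_coeff hp hinj hd
  refine Summable.of_norm_bounded (hu.mul_right M) fun j => ?_
  have hM0 : 0 ≤ M := (abs_nonneg _).trans (hM fun _ => 1)
  rw [norm_mul, Real.norm_eq_abs, Real.norm_eq_abs]
  calc _ ≤ _ * (((j + 1 : ℕ) : ℝ) * M) :=
        mul_le_mul_of_nonneg_left (abs_Psi_le μ hf hM (j + 1)) (abs_nonneg _)
    _ ≤ u j * M := by
        rw [← mul_assoc]
        exact mul_le_mul_of_nonneg_right (hle j) hM0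

/-- The series for the pressure of `t f` converges together with its derivatives in `t`. -/
theorem differentiable_pressure_series (hp : ∀ i, (p i).Prime) (hinj : Function.Injective p)
    (hd : 1 ≤ d) (hf : Continuous fstar) :
    Differentiable ℝ fun t : ℝ => kappa p * ∑' j : ℕ,
      (Real.exp (-rhoMinus p (j + 1)) - Real.exp (-rhoPlus p (j + 1))) *
        Psi p μ (fun τ => t * fstar τ) (j + 1) := by
  obtain ⟨M, hM⟩ := exists_abs_le_of_continuous hf
  have hM0 : 0 ≤ M := (abs_nonneg _).trans (hM fun _ => 1)
  obtain ⟨u, hu, hle⟩ := exists_summable_bound_coeff hp hinj hd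
  -- termwise differentiation; summability is only needed at the point `t = 0`
  choose D hD using fun j : ℕ => exists_hasDerivAt_Psi (p := p) μ hf hM (j + 1)
  intro t
  refine ((hasDerivAt_tsum (hu.mul_right M)
    (fun j s => ((hD j s).1.const_mul
      (Real.exp (-rhoMinus p (j + 1)) - Real.exp (-rhoPlus p (j + 1))))) (fun j s => ?_)
    (summable_pressure_series μ hp hinj hd (continuous_const.mul hf)
      (fstar := fun τ => 0 * fstar τ))
    t).differentiableAt).const_mul _
  rw [norm_mul, Real.norm_eq_abs, Real.norm_eq_abs]
  calc _ ≤ _ * (((j + 1 : ℕ) : ℝ) * M) :=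
        mul_le_mul_of_nonneg_left (hD j s).2 (abs_nonneg _)
    _ ≤ u j * M := by
        rw [← mul_assoc]
        exact mul_le_mul_of_nonneg_right (hle j) hM0

theorem tendsto_finitePressure (hp : ∀ i, (p i).Prime) (hinj : Function.Injective p)
    (hd : 1 ≤ d) {f : Config ℕ+ → ℝ} (hf : IsFirstLayer p f fstar) :
    Tendsto (finitePressure (layerProduct hp hinj μ) f) atTop
      (𝓝 (kappa p * ∑' j : ℕ,
        (Real.exp (-rhoMinus p (j + 1)) - Real.exp (-rhoPlus p (j + 1))) *
          Psi p μ fstar (j + 1))) := by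
  obtain ⟨M, hM⟩ := exists_abs_le_of_continuous hf.1
  have hM0 : 0 ≤ M := (abs_nonneg _).trans (hM fun _ => 1)
  obtain ⟨u, hu, hle⟩ := exists_summable_bound hp
  rw [← tsum_mul_left, funext fun N => finitePressure_eq_tsum hp hinj μ hf N]
  refine tendsto_tsum_of_dominated_convergence (hu.mul_right M) (fun j => ?_)
    (Eventually.of_forall fun N j => ?_)
  · rw [← mul_assoc]
    exact (tendsto_card_layersOfCard_div hp hinj hd (j + 1)).mul_const _
  · rw [norm_mul, Real.norm_eq_abs, Real.norm_eq_abs, abs_of_nonneg (by positivity)]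
    calc _ ≤ _ * (((j + 1 : ℕ) : ℝ) * M) :=
          mul_le_mul_of_nonneg_left (abs_Psi_le μ hf.1 hM (j + 1)) (by positivity)
      _ ≤ u j * M := by
          rw [← mul_assoc]
          exact mul_le_mul_of_nonneg_right (hle N j) hM0

end Count

/-! ### Large deviations from a differentiable pressure -/

section GartnerEllis

variable {Ω : Type} [MeasurableSpace Ω] {μ : Measure Ω} [IsProbabilityMeasure μ]

theorem inv_mul_log_le {N : ℕ} (hN : 1 ≤ N) {s : Set Ω} {c : ℝ}
    (h : μ.real s ≤ Real.exp (N * c)) :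
    ((1 / (N : ℝ) : ℝ) : EReal) * ENNReal.log (μ s) ≤ c := by
  have hN0 : (0 : ℝ) < N := by exact_mod_cast hN
  have h1 : ENNReal.log (μ s) ≤ ((N * c : ℝ) : EReal) := by
    rw [← ofReal_measureReal (μ := μ) (s := s), ← Real.log_exp (N * c),
      ← ENNReal.log_ofReal_of_pos (Real.exp_pos _)]
    exact ENNReal.log_le_log (ENNReal.ofReal_le_ofReal h)
  calc _ ≤ ((1 / (N : ℝ) : ℝ) : EReal) * ((N * c : ℝ) : EReal) :=
        mul_le_mul_of_nonneg_left h1 (EReal.coe_nonneg.2 (by positivity))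
    _ = c := by
        rw [← EReal.coe_mul]
        congr 1
        field_simp

theorem le_inv_mul_log {N : ℕ} (hN : 1 ≤ N) {s : Set Ω} {c : ℝ}
    (h : Real.exp (N * c) ≤ μ.real s) :
    (c : EReal) ≤ ((1 / (N : ℝ) : ℝ) : EReal) * ENNReal.log (μ s) := by
  have hN0 : (0 : ℝ) < N := by exact_mod_cast hN
  have h1 : ((N * c : ℝ) : EReal) ≤ ENNReal.log (μ s) := by
    rw [← ofReal_measureReal (μ := μ) (s := s), ← Real.log_exp (N * c),
      ← ENNReal.log_ofReal_of_pos (Real.exp_pos _)]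
    exact ENNReal.log_le_log (ENNReal.ofReal_le_ofReal h)
  calc (c : EReal) = ((1 / (N : ℝ) : ℝ) : EReal) * ((N * c : ℝ) : EReal) := by
        rw [← EReal.coe_mul]
        congr 1
        field_simp
    _ ≤ _ := mul_le_mul_of_nonneg_left h1 (EReal.coe_nonneg.2 (by positivity))

/-- The normalized logarithmic moment generating function `(1/N) log E exp (t N X_N)`. -/
def scaledCgf (μ : Measure Ω) (X : ℕ → Ω → ℝ) (N : ℕ) (t : ℝ) : ℝ :=
  1 / (N : ℝ) * Real.log (∫ ω, Real.exp (t * (N * X N ω)) ∂μ)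

variable {X : ℕ → Ω → ℝ} {M : ℝ}

theorem integrable_exp_scaled (hX : ∀ N, Measurable (X N)) (hM : ∀ N ω, |X N ω| ≤ M)
    (N : ℕ) (t : ℝ) : Integrable (fun ω => Real.exp (t * (N * X N ω))) μ := by
  refine integrable_exp_mul_of_abs_le_const (C := N * M) ((hX N).const_mul _) (fun ω => ?_) t
  rw [abs_mul, Nat.abs_cast]
  exact mul_le_mul_of_nonneg_left (hM N ω) (Nat.cast_nonneg N)

theorem exp_mul_scaledCgf (hX : ∀ N, Measurable (X N)) (hM : ∀ N ω, |X N ω| ≤ M)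
    {N : ℕ} (hN : 1 ≤ N) (t : ℝ) :
    Real.exp (N * scaledCgf μ X N t) = ∫ ω, Real.exp (t * (N * X N ω)) ∂μ := by
  have hN0 : (0 : ℝ) < N := by exact_mod_cast hN
  rw [scaledCgf, ← mul_assoc, mul_one_div_cancel hN0.ne', one_mul,
    Real.exp_log (integral_exp_pos (integrable_exp_scaled hX hM N t))]

/-- The Chernoff bound. -/
theorem measureReal_le_exp_scaledCgf (hX : ∀ N, Measurable (X N)) (hM : ∀ N ω, |X N ω| ≤ M)
    {N : ℕ} (hN : 1 ≤ N) (t c : ℝ) :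
    μ.real {ω | c ≤ t * X N ω} ≤ Real.exp (N * (scaledCgf μ X N t - c)) := by
  have hN0 : (0 : ℝ) < N := by exact_mod_cast hN
  have h := ProbabilityTheory.measure_ge_le_exp_mul_mgf (μ := μ) (X := fun ω => t * (N * X N ω))
    (N * c) zero_le_one (by simpa using integrable_exp_scaled hX hM N t)
  have hset : {ω | N * c ≤ t * (N * X N ω)} = {ω | c ≤ t * X N ω} := by
    ext ω
    simp only [Set.mem_ofPred_eq]
    rw [show t * (N * X N ω) = N * (t * X N ω) by ring]
    exact mul_le_mul_iff_right₀ hN0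
  rw [hset, ProbabilityTheory.mgf] at h
  simp only [one_mul] at h
  rw [← exp_mul_scaledCgf hX hM hN, ← Real.exp_add] at h
  convert h using 2
  ring

theorem eventually_le_exp_mul {c : ℝ} (hc : 0 < c) (b : ℝ) :
    ∀ᶠ N : ℕ in atTop, b ≤ Real.exp (N * c) :=
  (Real.tendsto_exp_atTop.comp
    (tendsto_natCast_atTop_atTop.atTop_mul_const hc)).eventually_ge_atTop b

variable {P : ℝ → ℝ}

theorem limsup_le_of_isClosed (hX : ∀ N, Measurable (X N)) (hM : ∀ N ω, |X N ω| ≤ M)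
    (hlim : ∀ t, Tendsto (fun N => scaledCgf μ X N t) atTop (𝓝 (P t))) {F : Set ℝ}
    (hF : IsClosed F) :
    limsup (fun N : ℕ => ((1 / (N : ℝ) : ℝ) : EReal) * ENNReal.log (μ {ω | X N ω ∈ F})) atTop
      ≤ -(⨅ x ∈ F, legendre P x) := by
  rw [EReal.le_neg]
  refine EReal.ge_of_forall_gt_iff_ge.1 fun a ha => ?_
  rw [EReal.le_neg]
  obtain ⟨a', haa', ha'⟩ := EReal.lt_iff_exists_real_btwn.1 ha
  have haa : a < a' := EReal.coe_lt_coe_iff.1 haa'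
  set δ := (a' - a) / 2 with hδ
  have hδ0 : 0 < δ := by linarith
  have hex : ∀ x ∈ F, ∃ t, a' < t * x - P t := by
    intro x hx
    have h : (a' : EReal) < legendre P x := ha'.trans_le (iInf₂_le x hx)
    obtain ⟨t, ht⟩ := lt_iSup_iff.1 h
    exact ⟨t, EReal.coe_lt_coe_iff.1 ht⟩
  choose! T hT using hex
  -- `X_N` takes values in `[-M, M]`, so finitely many Chernoff bounds cover `F`
  have hK : IsCompact (F ∩ Set.Icc (-M) M) := isCompact_Icc.inter_left hF
  obtain ⟨s, hsF, hs⟩ := hK.elim_nhds_subcover (fun x => {y | a' < T x * y - P (T x)})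
    fun x hx => (isOpen_lt continuous_const (by fun_prop)).mem_nhds (hT x hx.1)
  have hΛ : ∀ᶠ N : ℕ in atTop, ∀ x ∈ s, scaledCgf μ X N (T x) < P (T x) + δ :=
    (eventually_all_finset s).2 fun x _ => (hlim (T x)).eventually_lt_const (by linarith)
  refine limsup_le_of_le (h := ?_)
  filter_upwards [hΛ, eventually_le_exp_mul hδ0 s.card, eventually_ge_atTop 1] with N hN hcard hN1
  rw [← EReal.coe_neg]
  refine inv_mul_log_le hN1 ?_
  have hN0 : (0 : ℝ) < N := by exact_mod_cast hN1
  have hsub : {ω | X N ω ∈ F} ⊆ ⋃ x ∈ s, {ω | a' + P (T x) ≤ T x * X N ω} := by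
    intro ω hω
    obtain ⟨x, hx, hy⟩ := Set.mem_iUnion₂.1 (hs ⟨hω, abs_le.1 (hM N ω)⟩)
    have hy' : a' < T x * X N ω - P (T x) := hy
    refine Set.mem_iUnion₂.2 ⟨x, hx, ?_⟩
    change a' + P (T x) ≤ T x * X N ω
    linarith
  calc μ.real {ω | X N ω ∈ F}
      ≤ μ.real (⋃ x ∈ s, {ω | a' + P (T x) ≤ T x * X N ω}) := 
        measureReal_mono hsub (measure_ne_top μ _)
    _ ≤ ∑ x ∈ s, μ.real {ω | a' + P (T x) ≤ T x * X N ω} := measureReal_biUnion_finset_le _ _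
    _ ≤ ∑ x ∈ s, Real.exp (N * (δ - a')) := Finset.sum_le_sum fun x hx =>
        (measureReal_le_exp_scaledCgf hX hM hN1 _ _).trans (Real.exp_le_exp.2
          (mul_le_mul_of_nonneg_left (by linarith [hN x hx]) hN0.le))
    _ = s.card * Real.exp (N * (δ - a')) := by rw [Finset.sum_const, nsmul_eq_mul]
    _ ≤ Real.exp (N * δ) * Real.exp (N * (δ - a')) := by gcongr
    _ = Real.exp (N * -a) := by
        rw [← Real.exp_add]
        congr 1
        rw [hδ]
        ring

/-- The lower bound at an exposed point `y = P'(t)`: under the law tilted by `e^{t N X_N}`, the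
variable `X_N` concentrates at `y`. The tilting is done by comparing `t` with `t ± s`. -/
theorem le_liminf_of_hasDerivAt (hX : ∀ N, Measurable (X N)) (hM : ∀ N ω, |X N ω| ≤ M)
    (hlim : ∀ t, Tendsto (fun N => scaledCgf μ X N t) atTop (𝓝 (P t))) {t y : ℝ}
    (hP : HasDerivAt P y t) {G : Set ℝ} (hG : IsOpen G) (hy : y ∈ G) :
    ((P t - t * y : ℝ) : EReal) ≤
      liminf (fun N : ℕ => ((1 / (N : ℝ) : ℝ) : EReal) * ENNReal.log (μ {ω | X N ω ∈ G}))
        atTop := by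
  refine EReal.ge_of_forall_gt_iff_ge.1 fun z hz => ?_
  have hz' : z < P t - t * y := EReal.coe_lt_coe_iff.1 hz
  set ε := (P t - t * y - z) / 4 with hε
  have hε0 : 0 < ε := by linarith
  obtain ⟨η, hη0, hηG, hηε⟩ : ∃ η > 0, Metric.ball y η ⊆ G ∧ |t| * η ≤ ε := by
    obtain ⟨η₁, hη₁, hball⟩ := Metric.isOpen_iff.1 hG y hy
    refine ⟨min η₁ (ε / (|t| + 1)), lt_min hη₁ (by positivity),
      (Metric.ball_subset_ball (min_le_left _ _)).trans hball, ?_⟩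
    calc |t| * min η₁ (ε / (|t| + 1)) ≤ |t| * (ε / (|t| + 1)) :=
          mul_le_mul_of_nonneg_left (min_le_right _ _) (abs_nonneg t)
      _ = ε * (|t| / (|t| + 1)) := by ring
      _ ≤ ε * 1 := by
          refine mul_le_mul_of_nonneg_left ?_ hε0.le
          rw [div_le_one (by positivity)]
          linarith
      _ = ε := mul_one ε
  obtain ⟨s, hs0, hs1, hs2⟩ : ∃ s > 0, P (t + s) - P t - s * y ≤ η / 2 * s ∧
      P (t - s) - P t + s * y ≤ η / 2 * s := by
    have h := (hasDerivAt_iff_isLittleO_nhds_zero.1 hP).def (show 0 < η / 2 by linarith)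
    obtain ⟨r, hr0, hr⟩ := Metric.eventually_nhds_iff.1 h
    have hpos := hr (y := r / 2) (by simp [abs_of_pos hr0, hr0])
    have hneg := hr (y := -(r / 2)) (by simp [abs_of_pos hr0, hr0])
    rw [Real.norm_eq_abs, Real.norm_eq_abs, abs_of_pos (half_pos hr0), smul_eq_mul] at hpos
    rw [Real.norm_eq_abs, Real.norm_eq_abs, abs_neg, abs_of_pos (half_pos hr0), smul_eq_mul,
      neg_mul, sub_neg_eq_add, ← sub_eq_add_neg] at hneg
    exact ⟨r / 2, half_pos hr0, (le_abs_self _).trans hpos, (le_abs_self _).trans hneg⟩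
  set k := s * η / 8 with hk
  have hk0 : 0 < k := by positivity
  refine le_liminf_of_le (h := ?_)
  filter_upwards [(hlim t).eventually_const_lt (show P t - min k ε < P t by
      linarith [lt_min hk0 hε0]),
    (hlim (t + s)).eventually_lt_const (show P (t + s) < P (t + s) + k by linarith),
    (hlim (t - s)).eventually_lt_const (show P (t - s) < P (t - s) + k by linarith),
    eventually_le_exp_mul (show 0 < 2 * k by linarith) 4, eventually_le_exp_mul hε0 2,
    eventually_ge_atTop 1] with N h1 h2 h3 h4 h5 hN
  have hN0 : (0 : ℝ) < N := by exact_mod_cast hN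
  refine le_inv_mul_log hN ?_
  set q := scaledCgf μ X N t with hq
  have h1k : P t - k < q := by linarith [min_le_left k ε]
  have h1ε : P t - ε < q := by linarith [min_le_right k ε]
  have hGm : MeasurableSet {ω | X N ω ∈ G} := hX N hG.measurableSet
  -- split the exponential moment according to the position of `X_N` relative to `(y - η, y + η)`
  have hpt : ∀ ω, Real.exp (t * (N * X N ω)) ≤
      {ω | X N ω ∈ G}.indicator (fun _ => Real.exp (N * (t * y + |t| * η))) ω +
        (Real.exp (-(N * (s * (y + η)))) * Real.exp ((t + s) * (N * X N ω)) +
          Real.exp (N * (s * (y - η))) * Real.exp ((t - s) * (N * X N ω))) := by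
    intro ω
    have hind : 0 ≤ {ω | X N ω ∈ G}.indicator
        (fun _ => Real.exp (N * (t * y + |t| * η))) ω :=
      Set.indicator_nonneg (fun _ _ => (Real.exp_pos _).le) ω
    rw [← Real.exp_add, ← Real.exp_add]
    have e1 := Real.exp_pos (-(N * (s * (y + η))) + (t + s) * (N * X N ω))
    have e2 := Real.exp_pos (N * (s * (y - η)) + (t - s) * (N * X N ω))
    rcases le_or_gt (y + η) (X N ω) with hge | hlt
    · have : Real.exp (t * (N * X N ω)) ≤
          Real.exp (-(N * (s * (y + η))) + (t + s) * (N * X N ω)) := by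
        rw [Real.exp_le_exp]
        have := mul_nonneg hN0.le (mul_nonneg hs0.le (sub_nonneg.2 hge))
        linarith
      linarith
    rcases le_or_gt (X N ω) (y - η) with hle | hgt
    · have : Real.exp (t * (N * X N ω)) ≤
          Real.exp (N * (s * (y - η)) + (t - s) * (N * X N ω)) := by
        rw [Real.exp_le_exp]
        have := mul_nonneg hN0.le (mul_nonneg hs0.le (sub_nonneg.2 hle))
        linarith
      linarith
    · have habs : |X N ω - y| < η := abs_lt.2 ⟨by linarith, by linarith⟩
      have hmem : ω ∈ {ω | X N ω ∈ G} := hηG (by rwa [Metric.mem_ball, Real.dist_eq])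
      rw [Set.indicator_of_mem hmem]
      have : Real.exp (t * (N * X N ω)) ≤ Real.exp (N * (t * y + |t| * η)) := by
        rw [Real.exp_le_exp, show t * (N * X N ω) = N * (t * y + t * (X N ω - y)) by ring]
        refine mul_le_mul_of_nonneg_left ?_ hN0.le
        have := (le_abs_self (t * (X N ω - y))).trans_eq (abs_mul _ _)
        have := mul_le_mul_of_nonneg_left habs.le (abs_nonneg t)
        linarith
      linarith
  have hi1 := (integrable_exp_scaled (μ := μ) hX hM N (t + s)).const_mul
    (Real.exp (-(N * (s * (y + η)))))
  have hi2 := (integrable_exp_scaled (μ := μ) hX hM N (t - s)).const_mul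
    (Real.exp (N * (s * (y - η))))
  have hi0 : Integrable ({ω | X N ω ∈ G}.indicator
      fun _ => Real.exp (N * (t * y + |t| * η))) μ := (integrable_const _).indicator hGm
  have hi12 : Integrable (fun ω =>
      Real.exp (-(N * (s * (y + η)))) * Real.exp ((t + s) * (N * X N ω)) +
        Real.exp (N * (s * (y - η))) * Real.exp ((t - s) * (N * X N ω))) μ := hi1.add hi2
  have hmain := integral_mono (integrable_exp_scaled (μ := μ) hX hM N t) (hi0.add hi12) hpt
  simp only [Pi.add_apply] at hmain
  rw [integral_add hi0 hi12, integral_add hi1 hi2,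
    integral_indicator_const _ hGm, integral_const_mul, integral_const_mul,
    ← exp_mul_scaledCgf hX hM hN, ← exp_mul_scaledCgf hX hM hN, ← exp_mul_scaledCgf hX hM hN,
    ← Real.exp_add, ← Real.exp_add, ← hq, smul_eq_mul] at hmain
  -- the two outer parts are negligible
  have hsmall : Real.exp (N * q) / 4 ≥ Real.exp (N * (q - 2 * k)) := by
    rw [mul_sub, Real.exp_sub]
    exact div_le_div_of_nonneg_left (Real.exp_pos _).le (by norm_num) h4
  have ho1 : Real.exp (-(N * (s * (y + η))) + N * scaledCgf μ X N (t + s)) ≤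
      Real.exp (N * q) / 4 := by
    refine le_trans (Real.exp_le_exp.2 ?_) hsmall
    rw [neg_add_eq_sub, ← mul_sub]
    refine mul_le_mul_of_nonneg_left ?_ hN0.le
    linarith
  have ho2 : Real.exp (N * (s * (y - η)) + N * scaledCgf μ X N (t - s)) ≤
      Real.exp (N * q) / 4 := by
    refine le_trans (Real.exp_le_exp.2 ?_) hsmall
    rw [← mul_add]
    refine mul_le_mul_of_nonneg_left ?_ hN0.le
    linarith
  have hhalf : Real.exp (N * (q - ε)) ≤ Real.exp (N * q) / 2 := by
    rw [mul_sub, Real.exp_sub]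
    exact div_le_div_of_nonneg_left (Real.exp_pos _).le (by norm_num) h5
  have hfin : Real.exp (N * (q - ε)) ≤
      μ.real {ω | X N ω ∈ G} * Real.exp (N * (t * y + |t| * η)) := by linarith
  rw [← div_le_iff₀ (Real.exp_pos _), ← Real.exp_sub, ← mul_sub] at hfin
  refine le_trans (Real.exp_le_exp.2 (mul_le_mul_of_nonneg_left ?_ hN0.le)) hfin
  linarith

/-- If `t x - P t` is bounded above while `P'` stays below `x`, then `P'` comes close to `x` on the
positive half-line. -/
theorem exists_nonneg_lt_deriv {D : ℝ → ℝ} (hD : ∀ t, HasDerivAt P (D t) t) (h0 : P 0 = 0)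
    {x b δ : ℝ} (hb : ∀ t, t * x - P t ≤ b) (hδ : 0 < δ) : ∃ t, 0 ≤ t ∧ x - δ < D t := by
  by_contra! h
  have hb0 : 0 ≤ b := by simpa [h0] using hb 0
  have ht : 0 < (b + 1) / δ := by positivity
  obtain ⟨c, hc, hcD⟩ := exists_hasDerivAt_eq_slope P D ht
    (fun t _ => (hD t).continuousAt.continuousWithinAt) fun t _ => hD t
  have h1 := h c hc.1.le
  rw [hcD, h0, sub_zero, sub_zero, div_le_iff₀ ht] at h1
  have h2 := hb ((b + 1) / δ)
  have h3 : δ * ((b + 1) / δ) = b + 1 := mul_div_cancel₀ _ hδ.ne'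
  linarith

/-- Every `x` with a finite Legendre transform can be approached by exposed points `P'(t)` at no
greater cost. -/
theorem exists_deriv_near {D : ℝ → ℝ} (hD : ∀ t, HasDerivAt P (D t) t) (h0 : P 0 = 0)
    {x b δ : ℝ} (hb : ∀ t, t * x - P t ≤ b) (hδ : 0 < δ) :
    ∃ t, |D t - x| < δ ∧ t * D t ≤ t * x := by
  by_cases hx : ∃ t, D t = x
  · obtain ⟨t, rfl⟩ := hx
    exact ⟨t, by simpa using hδ, le_rfl⟩
  push Not at hx
  rcases hasDerivWithinAt_forall_lt_or_forall_gt_of_forall_ne convex_univ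
    (fun t _ => (hD t).hasDerivWithinAt) (fun t _ => hx t) with hlt | hgt
  · obtain ⟨t, ht0, ht⟩ := exists_nonneg_lt_deriv hD h0 hb hδ
    have := hlt t trivial
    exact ⟨t, abs_lt.2 ⟨by linarith, by linarith⟩, mul_le_mul_of_nonneg_left this.le ht0⟩
  · -- reflect to reduce to the previous case
    obtain ⟨t, ht0, ht⟩ := exists_nonneg_lt_deriv (P := fun t => P (-t)) (D := fun t => -D (-t))
      (fun t => by
        simpa [Function.comp_def] using (hD (-t)).scomp t (hasDerivAt_neg t)) (by simpa using h0)
      (x := -x) (fun t => by simpa using hb (-t)) hδ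
    have := hgt (-t) trivial
    exact ⟨-t, abs_lt.2 ⟨by linarith, by linarith⟩, by nlinarith⟩

/-- The Gärtner–Ellis theorem on the line, for uniformly bounded random variables with a
differentiable pressure. -/
theorem satisfiesLDP_of_tendsto_scaledCgf (hX : ∀ N, Measurable (X N))
    (hM : ∀ N ω, |X N ω| ≤ M)
    (hlim : ∀ t, Tendsto (fun N => scaledCgf μ X N t) atTop (𝓝 (P t)))
    (hP : Differentiable ℝ P) : SatisfiesLDP μ X (legendre P) := by
  have h0 : P 0 = 0 := tendsto_nhds_unique (hlim 0) (by simp [scaledCgf])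
  have hnonneg : ∀ x, 0 ≤ legendre P x := fun x => by
    have h : ((0 * x - P 0 : ℝ) : EReal) ≤ legendre P x :=
      le_iSup (fun t : ℝ => ((t * x - P t : ℝ) : EReal)) 0
    simpa [h0] using h
  refine ⟨hnonneg, ?_, fun F hF => limsup_le_of_isClosed hX hM hlim hF, fun G hG => ?_⟩
  · refine lowerSemicontinuous_iSup fun t => Continuous.lowerSemicontinuous ?_
    exact continuous_coe_real_ereal.comp (by fun_prop)
  · rw [EReal.neg_le]
    refine le_iInf₂ fun x hx => ?_
    rw [EReal.neg_le]
    by_cases htop : legendre P x = ⊤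
    · rw [htop, EReal.neg_top]
      exact bot_le
    have hle : ∀ t, ((t * x - P t : ℝ) : EReal) ≤ legendre P x := fun t =>
      le_iSup (fun t : ℝ => ((t * x - P t : ℝ) : EReal)) t
    have hb : ∀ t, t * x - P t ≤ (legendre P x).toReal := fun t => by
      rw [← EReal.coe_le_coe_iff, EReal.coe_toReal htop
        (ne_of_gt (lt_of_lt_of_le EReal.bot_lt_zero (hnonneg x)))]
      exact hle t
    obtain ⟨δ, hδ, hball⟩ := Metric.isOpen_iff.1 hG x hx
    obtain ⟨t, ht, htx⟩ := exists_deriv_near (fun t => (hP t).hasDerivAt) h0 hb hδ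
    refine le_trans ?_ (le_liminf_of_hasDerivAt hX hM hlim (hP t).hasDerivAt hG
      (hball (by rwa [Metric.mem_ball, Real.dist_eq])))
    rw [EReal.neg_le, ← EReal.coe_neg]
    refine le_trans (EReal.coe_le_coe_iff.2 ?_) (hle t)
    linarith

end GartnerEllis

/-! ### Large deviations of the multiplicative averages -/

section Averages

variable {d : ℕ} {p : Fin d → ℕ} {f : Config ℕ+ → ℝ} {fstar : Config (LayerSite d) → ℝ}

theorem IsFirstLayer.continuous (hf : IsFirstLayer p f fstar) : Continuous f := by
  rw [funext hf.2]
  exact hf.1.comp (continuous_pi fun _ => continuous_apply _)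

theorem IsFirstLayer.const_mul (hf : IsFirstLayer p f fstar) (t : ℝ) :
    IsFirstLayer p (fun σ => t * f σ) fun τ => t * fstar τ :=
  ⟨continuous_const.mul hf.1, fun σ => congrArg (t * ·) (hf.2 σ)⟩

theorem measurable_multAverage (hf : Continuous f) (N : ℕ) : Measurable (multAverage f N) :=
  (continuous_const.mul (continuous_finsetSum _ fun _ _ =>
    hf.comp (continuous_pi fun j => continuous_apply (_ * j)))).measurable

theorem abs_multAverage_le {M : ℝ} (hM : ∀ σ, |f σ| ≤ M) (N : ℕ) (σ : Config ℕ+) :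
    |multAverage f N σ| ≤ M := by
  have hM0 : 0 ≤ M := (abs_nonneg _).trans (hM σ)
  have h : |multSum f N σ| ≤ N * M :=
    calc _ ≤ ∑ i ∈ Finset.range N, |f (multShift i.succPNat σ)| := Finset.abs_sum_le_sum_abs _ _
      _ ≤ ∑ i ∈ Finset.range N, M := Finset.sum_le_sum fun i _ => hM _
      _ = N * M := by rw [Finset.sum_const, Finset.card_range, nsmul_eq_mul]
  rcases Nat.eq_zero_or_pos N with rfl | hN
  · simpa [multAverage] using hM0
  · have hN0 : (0 : ℝ) < N := by exact_mod_cast hN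
    rw [multAverage, abs_mul, abs_of_pos (by positivity : 0 < 1 / (N : ℝ)), one_div,
      inv_mul_le_iff₀ hN0]
    exact h

theorem scaledCgf_multAverage (μ : Measure (Config ℕ+)) (f : Config ℕ+ → ℝ) (N : ℕ) (t : ℝ) :
    scaledCgf μ (multAverage f) N t = finitePressure μ (fun σ => t * f σ) N := by
  rcases Nat.eq_zero_or_pos N with rfl | hN
  · simp [scaledCgf, finitePressure]
  · have hN0 : (N : ℝ) ≠ 0 := by positivity
    have h : ∀ σ, t * (N * multAverage f N σ) = multSum (fun σ => t * f σ) N σ := fun σ => by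
      rw [multAverage, ← mul_assoc (N : ℝ), mul_one_div_cancel hN0, one_mul, multSum, multSum,
        Finset.mul_sum]
    simp only [scaledCgf, finitePressure, h]

end Averages

end MultGibbs
end

theorem mainTheorem3
    (𝒜 : Set (Finset ℕ+)) (J : Finset ℕ+ → ℝ)
    (h𝒜 : ∀ A ∈ 𝒜, A.Nonempty) (hJ : MultGibbs.Consistent 𝒜 J)
    (hU : MultGibbs.AbsolutelySummable (MultGibbs.multPotential 𝒜 J))
    (d : ℕ) (hd : 1 ≤ d) (p : Fin d → ℕ) (hp : StrictMono p)
    (hprimes : Set.range p = MultGibbs.basePrimes 𝒜)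
    (μV : MeasureTheory.Measure (MultGibbs.Config (MultGibbs.LayerSite d)))
    (hV : MultGibbs.IsUniqueGibbs (MultGibbs.layerPotential p 𝒜 J) μV) :
    ∃ μU : MeasureTheory.Measure (MultGibbs.Config ℕ+),
      MultGibbs.IsUniqueGibbs (MultGibbs.multPotential 𝒜 J) μU ∧
      ∀ (f : MultGibbs.Config ℕ+ → ℝ)
        (fstar : MultGibbs.Config (MultGibbs.LayerSite d) → ℝ),
        MultGibbs.IsFirstLayer p f fstar →
        Filter.Tendsto (MultGibbs.finitePressure μU f) Filter.atTop
          (nhds (MultGibbs.multPressure μU f)) ∧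
        Summable (fun j : ℕ =>
          (Real.exp (-MultGibbs.rhoMinus p (j + 1)) - Real.exp (-MultGibbs.rhoPlus p (j + 1))) *
            MultGibbs.Psi p μV fstar (j + 1)) ∧
        MultGibbs.multPressure μU f = MultGibbs.kappa p * ∑' j : ℕ,
          (Real.exp (-MultGibbs.rhoMinus p (j + 1)) - Real.exp (-MultGibbs.rhoPlus p (j + 1))) *
            MultGibbs.Psi p μV fstar (j + 1) ∧
        MultGibbs.SatisfiesLDP μU (MultGibbs.multAverage f)
          (MultGibbs.legendre fun t => MultGibbs.multPressure μU fun σ => t * f σ) := by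
  have hinj := hp.injective
  have hprime := MultGibbs.prime_of_range_eq_basePrimes hprimes
  have := hV.1.isProbabilityMeasure
  refine ⟨MultGibbs.layerProduct hprime hinj μV,
    MultGibbs.layerProduct_isUniqueGibbs h𝒜 hJ hU hinj hprimes hV, fun f fstar hf => ?_⟩
  have hlim := fun t => MultGibbs.tendsto_finitePressure μV hprime hinj hd (hf.const_mul t)
  have heq := MultGibbs.tendsto_finitePressure μV hprime hinj hd hf
  have hP := heq.limUnder_eq
  refine ⟨?_, MultGibbs.summable_pressure_series μV hprime hinj hd hf.1, hP, ?_⟩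
  · rw [MultGibbs.multPressure, hP]
    exact heq
  · obtain ⟨M, hM⟩ := MultGibbs.exists_abs_le_of_continuous hf.continuous
    have hPt := funext fun t => (hlim t).limUnder_eq
    unfold MultGibbs.multPressure
    rw [hPt]
    refine MultGibbs.satisfiesLDP_of_tendsto_scaledCgf
      (MultGibbs.measurable_multAverage hf.continuous) (MultGibbs.abs_multAverage_le hM)
      (fun t => ?_) (MultGibbs.differentiable_pressure_series μV hprime hinj hd hf.1)
    simp only [MultGibbs.scaledCgf_multAverage]
    exact hlim t
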